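/- Let $\mathscr{M}_+((0,\infty))$ be the set of non-negative Radon measures on $(0,\infty)$. Let $\gamma>1$ and let $K\colon[0,\infty)\times[0,\infty)\to[0,\infty)$ be a kernel of the form $K(v,v')=h(v,v')\,g\big(\tfrac{v}{v+v'}\big)$ for $(v,v')\neq(0,0)$, where $h\in C([0,\infty)^2)$ and $g\in C([0,\infty))$ are real-valued and satisfy the following. - $h$ is symmetric; there are $H>1$ and $H_0>0$ with $H_0(v^\gamma+v'^\gamma)\le h(v,v')$ whenever $v+v'>H$; for every $R>0$ there is $C_R>0$ with $h(v,v')\ge C_R$ for all $v,v'\in[\tfrac1R,R]$; and there is $H_1>0$ with $h(v,v')\le H_1(v^\gamma+v'^\gamma)$ for all $v,v'\in[0,\infty)$. - $g(x)=g(1-x)$ for $x\in[0,1]$, $g(\tfrac12)=0$, and there are $G_0,G_1>0$ and $k\ge1$ with $G_0|x-\tfrac12|^k\le g(x)\le G_1$ for all $x\in[0,1]$. Let $T\in(0,\infty]$; for $T=\infty$ read $[0,T]$ as $[0,\infty)$. Let $f_{\rm in}\in\mathscr{M}_+((0,\infty))$ with $f_{\rm in}\neq0$. A mass-conserving (weak)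 solution on $[0,T]$ of the coagulation equation $$\partial_t f(v,t)=\tfrac12\int_{(0,v)}K(v-v',v')f(v-v',t)f(v',t)\,dv'-\int_{(0,\infty)}K(v,v')f(v,t)f(v',t)\,dv'$$ with initial datum $f_{\rm in}$ is a family $(f(\cdot,t))_{t\in[0,T]}$ in $\mathscr{M}_+((0,\infty))$, continuous in $t$ for the vague topology (that is, $t\mapsto\int_{(0,\infty)}\varphi(v)f(v,t)\,dv$ is continuous on $[0,T]$ for every $\varphi\in C_c((0,\infty))$), such that $\sup_{t\in[0,T]}\int_{(0,\infty)}(1+v^\gamma)f(v,t)\,dv<\infty$, such that for every $\varphi\in C_c((0,\infty))$ and every $t\in[0,T]$ $$\int_{(0,\infty)}\varphi(v) f(v,t)\,dv-\int_{(0,\infty)}\varphi(v) f_{\rm in}(v)\,dv=\frac12\int_0^t\int_{(0,\infty)}\int_{(0,\infty)}K(v,v')\big[\varphi(v+v')-\varphi(v)-\varphi(v')\big]f(v,s)f(v',s)\,dv\,dv'\,ds,$$ and such that $\int_{(0,\infty)}v f(v,t)\,dv=\int_{(0,\infty)}v f_{\rm in}(v)\,dv$ for all $t\in[0,T]$. Here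 $f(v,t)\,dv$ and $f_{\rm in}(v)\,dv$ denote integration against the measures, which need not have densities. Then a mass-conserving solution on $[0,T]$ with initial datum $f_{\rm in}$ exists if and only if $f_{\rm in}=M\delta_V$ for some $M,V\in(0,\infty)$. -/

import Mathlib

open MeasureTheory Set
open scoped ENNReal NNReal CompactlySupported

namespace Coagulation

/-- The space `(0, ∞)` of particle volumes, with the topology and the Borel sets inherited from
`ℝ`, and with addition of positive numbers. A Radon measure on it is a Borel measure that is
finite on compact subsets of `(0, ∞)`, that is, a locally finite one (regularity is automatic). -/
abbrev Vol : Type := {v : ℝ // 0 < v}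

/-- The assumption on the kernel `K : [0, ∞) × [0, ∞) → [0, ∞)`, with exponent `γ > 1`. Only the
values of `K`, `h` on `[0, ∞)²` and of `g` on `[0, ∞)` matter. The quotient `v / (v + v')` is
undefined at the origin, so the factorization is required away from it. -/
structure KernelAssumption (γ : ℝ) (K : ℝ → ℝ → ℝ) : Prop where
  one_lt : 1 < γ
  nonneg : ∀ v v' : ℝ, 0 ≤ v → 0 ≤ v' → 0 ≤ K v v'
  factorization : ∃ (h : ℝ → ℝ → ℝ) (g : ℝ → ℝ),
    ContinuousOn (Function.uncurry h) (Ici 0 ×ˢ Ici 0) ∧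
    ContinuousOn g (Ici 0) ∧
    (∀ v v' : ℝ, 0 ≤ v → 0 ≤ v' → 0 < v + v' → K v v' = h v v' * g (v / (v + v'))) ∧
    (∀ v v' : ℝ, 0 ≤ v → 0 ≤ v' → h v v' = h v' v) ∧
    (∃ H H₀ : ℝ, 1 < H ∧ 0 < H₀ ∧ ∀ v v' : ℝ, 0 ≤ v → 0 ≤ v' → H < v + v' →
      H₀ * (v ^ γ + v' ^ γ) ≤ h v v') ∧
    (∀ R : ℝ, 0 < R → ∃ C : ℝ, 0 < C ∧
      ∀ v ∈ Icc (1 / R) R, ∀ v' ∈ Icc (1 / R) R, C ≤ h v v') ∧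
    (∃ H₁ : ℝ, 0 < H₁ ∧ ∀ v v' : ℝ, 0 ≤ v → 0 ≤ v' → h v v' ≤ H₁ * (v ^ γ + v' ^ γ)) ∧
    (∀ x ∈ Icc (0 : ℝ) 1, g x = g (1 - x)) ∧
    g (1 / 2) = 0 ∧
    (∃ G₀ G₁ k : ℝ, 0 < G₀ ∧ 0 < G₁ ∧ 1 ≤ k ∧
      ∀ x ∈ Icc (0 : ℝ) 1, G₀ * |x - 1 / 2| ^ k ≤ g x ∧ g x ≤ G₁)

/-- The interval `[0, T]` of times, for `T ∈ (0, ∞]`; it is `[0, ∞)` when `T = ∞`. -/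
def timeInterval (T : ℝ≥0∞) : Set ℝ := {t : ℝ | 0 ≤ t ∧ ENNReal.ofReal t ≤ T}

/-- `Θ_φ(v, v') = φ(v + v') - φ(v) - φ(v')`. -/
def Theta (φ : Vol → ℝ) (v v' : Vol) : ℝ := φ (v + v') - φ v - φ v'

/-- `f ∈ C([0, T]; 𝓜₊((0, ∞), 1 + v^γ))` is a weak solution of the coagulation equation with
kernel `K` and initial datum `fin`. Values of `f` outside `[0, T]` are irrelevant.
Continuity in time is that for the vague topology, the coarsest one for which the pairing with
each compactly supported continuous function is continuous. For kernels as in `KernelAssumption`,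
the moment bound and the vague continuity make all integrals in the weak equation
absolutely convergent. -/
structure IsWeakSolution (γ : ℝ) (K : ℝ → ℝ → ℝ) (T : ℝ≥0∞) (fin : Measure Vol)
    (f : ℝ → Measure Vol) : Prop where
  radon : ∀ t ∈ timeInterval T, IsLocallyFiniteMeasure (f t)
  continuous : ∀ φ : C_c(Vol, ℝ), ContinuousOn (fun t => ∫ v, φ v ∂(f t)) (timeInterval T)
  moment_bound : ∃ C : ℝ≥0, ∀ t ∈ timeInterval T,
    ∫⁻ v : Vol, ENNReal.ofReal (1 + (v : ℝ) ^ γ) ∂(f t) ≤ C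
  weak_eq : ∀ φ : C_c(Vol, ℝ), ∀ t ∈ timeInterval T,
    ∫ v, φ v ∂(f t) - ∫ v, φ v ∂fin =
      1 / 2 * ∫ s in (0 : ℝ)..t, ∫ v' : Vol, ∫ v : Vol,
        K v v' * Theta φ v v' ∂(f s) ∂(f s)

/-- A mass-conserving solution on `[0, T]`: a weak solution with
`∫ v f(v,t) dv = ∫ v fin(v) dv` for all `t ∈ [0, T]`. -/
structure IsMassConservingSolution (γ : ℝ) (K : ℝ → ℝ → ℝ) (T : ℝ≥0∞) (fin : Measure Vol)
    (f : ℝ → Measure Vol) : Prop extends IsWeakSolution γ K T fin f where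
  mass_conserved : ∀ t ∈ timeInterval T,
    ∫⁻ v : Vol, ENNReal.ofReal (v : ℝ) ∂(f t) = ∫⁻ v : Vol, ENNReal.ofReal (v : ℝ) ∂fin

end Coagulation

open Filter Topology ProbabilityTheory

namespace Coagulation

/-! ### Consequences of the kernel assumption -/

namespace KernelAssumption

variable {γ : ℝ} {K : ℝ → ℝ → ℝ}

/-! If `fin` is `M δ_V`, the constant family is a solution, because two particles of equal volume
never react: `K` vanishes on the diagonal.

For the converse, two facts about the support of a mass-conserving solution are incompatible unless
`fin` sits at one point.

The support is bounded at every time before the last (`exists_ae_le`). Let `E(y,t)` be the smoothed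
mass excess above `y` and `N(y,t)` the smoothed number of particles above `y`, so that `∂_y E = -N`.
A particle of volume at least `y ≥ R` absorbs the much smaller ones, which carry at least half of
the mass, at a rate of order `R^γ`; hence `∂_t E ≥ q N` with `q = κ R^γ`, and `E` does not decrease
along lines of slope `q` (`collision_excess_ge`, `excess_advance`). So the excess above `R` reaches
`2R` within time `R^(1-γ)/κ`. As `γ > 1`, these times are summable over successive doublings, and
for `R` large their sum is less than the time left. The excess above `R` would thus escape to
infinite volume before the final time, while the `γ`-moment bound forces the excess above `2^j R` to
tend to zero. Hence it was zero.

The support also becomes unbounded at once if it has two points `a ≠ b` (`exists_charges_gt`).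
Support points persist, since losses are at most exponential (`integral_eq_zero_of_le`), and `K > 0`
off the diagonal, so `a + b`, `a + 2b`, ... are charged at every positive time (`charges_add`).

Mass conservation enters by allowing test functions at bounded distance from a linear one, such as
the excess (`weak_eq_test`). -/

theorem div_add_mem_Icc (v v' : Vol) : (v : ℝ) / (v + v') ∈ Icc (0 : ℝ) 1 := by
  have hv := v.2
  have hv' := v'.2
  refine ⟨by positivity, ?_⟩
  rw [div_le_one (by positivity)]
  linarith

theorem continuous_vol (hK : KernelAssumption γ K) :
    Continuous (fun p : Vol × Vol => K p.1 p.2) := by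
  obtain ⟨h, g, hh, hg, hfac, -⟩ := hK.factorization
  have heq : (fun p : Vol × Vol => K p.1 p.2) =
      fun p : Vol × Vol => Function.uncurry h ((p.1 : ℝ), (p.2 : ℝ)) *
        g ((p.1 : ℝ) / (p.1 + p.2)) := by
    funext p
    exact hfac _ _ p.1.2.le p.2.2.le (add_pos p.1.2 p.2.2)
  rw [heq]
  refine Continuous.mul ?_ ?_
  · exact hh.comp_continuous (by fun_prop) fun p => ⟨p.1.2.le, p.2.2.le⟩
  · refine hg.comp_continuous ?_ fun p => (div_add_mem_Icc p.1 p.2).1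
    exact Continuous.div (by fun_prop) (by fun_prop) fun p => (add_pos p.1.2 p.2.2).ne'

theorem exists_upper_bound (hK : KernelAssumption γ K) :
    ∃ Λ : ℝ, 0 ≤ Λ ∧ ∀ v v' : Vol, K v v' ≤ Λ * ((v : ℝ) ^ γ + (v' : ℝ) ^ γ) := by
  obtain ⟨h, g, -, -, hfac, -, -, -, ⟨H₁, hH₁, hup⟩, -, -, G₀, G₁, k, hG₀, hG₁, -, hg⟩ :=
    hK.factorization
  refine ⟨H₁ * G₁, by positivity, fun v v' => ?_⟩
  have hx := hg _ (div_add_mem_Icc v v')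
  have hg0 : 0 ≤ g ((v : ℝ) / (v + v')) := le_trans (by positivity) hx.1
  have hv := v.2
  have hv' := v'.2
  rw [hfac _ _ v.2.le v'.2.le (add_pos v.2 v'.2)]
  calc h v v' * g ((v : ℝ) / (v + v'))
      ≤ H₁ * ((v : ℝ) ^ γ + (v' : ℝ) ^ γ) * g ((v : ℝ) / (v + v')) :=
        mul_le_mul_of_nonneg_right (hup _ _ v.2.le v'.2.le) hg0
    _ ≤ H₁ * ((v : ℝ) ^ γ + (v' : ℝ) ^ γ) * G₁ :=
        mul_le_mul_of_nonneg_left hx.2 (by positivity)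
    _ = _ := by ring

theorem diagonal (hK : KernelAssumption γ K) (v : Vol) : K v v = 0 := by
  obtain ⟨h, g, -, -, hfac, -, -, -, -, -, hg0, -⟩ := hK.factorization
  have hv := v.2
  rw [hfac _ _ v.2.le v.2.le (add_pos v.2 v.2)]
  have : (v : ℝ) / (v + v) = 1 / 2 := by field_simp; norm_num
  rw [this, hg0, mul_zero]

theorem pos_of_ne (hK : KernelAssumption γ K) {v v' : Vol} (hne : v ≠ v') : 0 < K v v' := by
  obtain ⟨h, g, -, -, hfac, -, -, hlow, -, -, -, G₀, G₁, k, hG₀, -, -, hg⟩ := hK.factorization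
  have hv := v.2
  have hv' := v'.2
  rw [hfac _ _ v.2.le v'.2.le (add_pos v.2 v'.2)]
  set R : ℝ := max (max (v : ℝ) v') (max (1 / (v : ℝ)) (1 / (v' : ℝ))) with hR
  have h1 : (v : ℝ) ≤ R := (le_max_left _ _).trans (le_max_left _ _)
  have h2 : (v' : ℝ) ≤ R := (le_max_right _ _).trans (le_max_left _ _)
  have h3 : 1 / (v : ℝ) ≤ R := (le_max_left _ _).trans (le_max_right _ _)
  have h4 : 1 / (v' : ℝ) ≤ R := (le_max_right _ _).trans (le_max_right _ _)
  have hRpos : 0 < R := hv.trans_le h1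
  obtain ⟨C, hC, hCle⟩ := hlow R hRpos
  refine mul_pos (hC.trans_le (hCle _ ⟨?_, h1⟩ _ ⟨?_, h2⟩)) ?_
  · exact (one_div_le hv hRpos).1 h3
  · exact (one_div_le hv' hRpos).1 h4
  · refine lt_of_lt_of_le ?_ (hg _ (div_add_mem_Icc v v')).1
    refine mul_pos hG₀ (Real.rpow_pos_of_pos (abs_pos.2 fun h0 => hne ?_) _)
    rw [sub_eq_zero, div_eq_div_iff (by positivity) (by norm_num)] at h0
    exact Subtype.ext (by linarith)

theorem exists_lower_bound (hK : KernelAssumption γ K) :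
    ∃ H c : ℝ, 0 < H ∧ 0 < c ∧ ∀ v v' : Vol, H ≤ v → (v' : ℝ) ≤ v / 4 →
      c * (v : ℝ) ^ γ ≤ K v v' := by
  obtain ⟨h, g, -, -, hfac, -, ⟨H, H₀, hH, hH₀, hlow⟩, -, -, -, -, G₀, G₁, k, hG₀, -, hk, hg⟩ :=
    hK.factorization
  -- For `v' ≤ v / 4` the fraction `v / (v + v')` is at least `4/5`, hence at distance at least
  -- `3/10` from the zero `1/2` of `g`.
  refine ⟨H, H₀ * (G₀ * (3 / 10) ^ k), by linarith, by positivity, fun v v' hHv hv4 => ?_⟩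
  have hv := v.2
  have hv' := v'.2
  rw [hfac _ _ v.2.le v'.2.le (add_pos v.2 v'.2)]
  have h1 : H₀ * (v : ℝ) ^ γ ≤ h v v' := by
    refine le_trans ?_ (hlow _ _ hv.le hv'.le (by linarith))
    have : 0 ≤ (v' : ℝ) ^ γ := by positivity
    nlinarith
  have h2 : G₀ * (3 / 10) ^ k ≤ g ((v : ℝ) / (v + v')) := by
    refine le_trans ?_ (hg _ (div_add_mem_Icc v v')).1
    have h45 : (4 : ℝ) / 5 ≤ (v : ℝ) / (v + v') := by
      rw [div_le_div_iff₀ (by norm_num) (by positivity)]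
      linarith
    have : (3 : ℝ) / 10 ≤ |(v : ℝ) / (v + v') - 1 / 2| := le_trans (by linarith) (le_abs_self _)
    gcongr
  calc H₀ * (G₀ * (3 / 10) ^ k) * (v : ℝ) ^ γ
      = H₀ * (v : ℝ) ^ γ * (G₀ * (3 / 10) ^ k) := by ring
    _ ≤ _ := mul_le_mul h1 h2 (by positivity) (le_trans (by positivity) h1)

end KernelAssumption

/-! ### Compactly supported functions of the volume -/

theorem isCompact_vol_Icc {a : ℝ} (ha : 0 < a) (b : ℝ) :
    IsCompact {v : Vol | a ≤ v ∧ (v : ℝ) ≤ b} := by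
  rw [Topology.IsEmbedding.subtypeVal.isCompact_iff]
  have : ((↑) : Vol → ℝ) '' {v : Vol | a ≤ v ∧ (v : ℝ) ≤ b} = Icc a b := by
    ext x
    constructor
    · rintro ⟨v, hv, rfl⟩
      exact hv
    · intro hx
      exact ⟨⟨x, ha.trans_le hx.1⟩, hx, rfl⟩
  rw [this]
  exact isCompact_Icc

/-- A continuous function on `(0, ∞)` vanishing outside `[a, b]`, as a compactly supported one. -/
def mkCompactlySupported (φ : Vol → ℝ) (hφ : Continuous φ) {a : ℝ} (ha : 0 < a) (b : ℝ)
    (h : ∀ v : Vol, ¬ (a ≤ v ∧ (v : ℝ) ≤ b) → φ v = 0) : C_c(Vol, ℝ) where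
  toFun := φ
  continuous_toFun := hφ
  hasCompactSupport' := HasCompactSupport.intro (isCompact_vol_Icc ha b) fun v hv => h v hv

/-- Continuous functions increasing to `1`, with compact support in `(0, ∞)`. -/
noncomputable def cutoff (n : ℕ) (v : Vol) : ℝ :=
  max 0 (min 1 (min ((n + 1) * (v : ℝ) - 1) (n + 2 - v)))

theorem continuous_cutoff (n : ℕ) : Continuous (cutoff n) := by
  unfold cutoff
  fun_prop

theorem cutoff_nonneg (n : ℕ) (v : Vol) : 0 ≤ cutoff n v := le_max_left _ _

theorem cutoff_le_one (n : ℕ) (v : Vol) : cutoff n v ≤ 1 :=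
  max_le zero_le_one (min_le_left _ _)

theorem cutoff_eq_zero (n : ℕ) (v : Vol) (hv : ¬ (1 / ((n : ℝ) + 1) ≤ v ∧ (v : ℝ) ≤ n + 2)) :
    cutoff n v = 0 := by
  refine max_eq_left ((min_le_right _ _).trans ?_)
  rw [not_and_or, not_le, not_le] at hv
  rcases hv with hv | hv
  · refine (min_le_left _ _).trans ?_
    rw [lt_div_iff₀ (by positivity)] at hv
    linarith
  · exact (min_le_right _ _).trans (by linarith)

theorem eventually_cutoff_eq_one (v : Vol) : ∀ᶠ n : ℕ in atTop, cutoff n v = 1 := by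
  obtain ⟨N, hN⟩ := exists_nat_gt (max (2 / (v : ℝ)) v)
  have h1 : 2 / (v : ℝ) < N := (le_max_left _ _).trans_lt hN
  have h2 : (v : ℝ) < N := (le_max_right _ _).trans_lt hN
  filter_upwards [eventually_ge_atTop N] with n hn
  have hn' : (N : ℝ) ≤ n := by exact_mod_cast hn
  have hv := v.2
  rw [div_lt_iff₀ hv] at h1
  have h3 : (1 : ℝ) ≤ min ((n + 1) * (v : ℝ) - 1) (n + 2 - v) :=
    le_min (by nlinarith) (by linarith)
  rw [cutoff, min_eq_left h3, max_eq_right zero_le_one]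

/-- The product of a continuous function with a cutoff. -/
noncomputable def cutoffMul (φ : Vol → ℝ) (hφ : Continuous φ) (n : ℕ) : C_c(Vol, ℝ) :=
  mkCompactlySupported (fun v => cutoff n v * φ v) ((continuous_cutoff n).mul hφ)
    (a := 1 / ((n : ℝ) + 1)) (by positivity) (n + 2)
    fun v hv => by rw [cutoff_eq_zero n v hv, zero_mul]

theorem cutoffMul_apply (φ : Vol → ℝ) (hφ : Continuous φ) (n : ℕ) (v : Vol) :
    cutoffMul φ hφ n v = cutoff n v * φ v := rfl

theorem abs_cutoffMul_le (φ : Vol → ℝ) (hφ : Continuous φ) (n : ℕ) (v : Vol) :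
    |cutoffMul φ hφ n v| ≤ |φ v| := by
  rw [cutoffMul_apply, abs_mul, abs_of_nonneg (cutoff_nonneg n v)]
  exact mul_le_of_le_one_left (abs_nonneg _) (cutoff_le_one n v)

theorem tendsto_cutoffMul (φ : Vol → ℝ) (hφ : Continuous φ) (v : Vol) :
    Tendsto (fun n => cutoffMul φ hφ n v) atTop (𝓝 (φ v)) := by
  refine tendsto_const_nhds.congr' ?_
  filter_upwards [eventually_cutoff_eq_one v] with n hn
  rw [cutoffMul_apply, hn, one_mul]

/-- A bump of radius `r` around `a`. -/
noncomputable def bump (a : Vol) (r : ℝ) (hr : 0 < r) (hra : r < a) : C_c(Vol, ℝ) :=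
  mkCompactlySupported (fun v => max 0 (1 - |(v : ℝ) - a| / r)) (by fun_prop)
    (a := (a : ℝ) - r) (by linarith) (a + r) fun v hv => by
      refine max_eq_left ?_
      rw [sub_nonpos, le_div_iff₀ hr, one_mul]
      by_contra hlt
      rw [not_le, abs_lt] at hlt
      exact hv ⟨by linarith, by linarith⟩

theorem bump_apply (a : Vol) (r : ℝ) (hr : 0 < r) (hra : r < a) (v : Vol) :
    bump a r hr hra v = max 0 (1 - |(v : ℝ) - a| / r) := rfl

theorem bump_nonneg (a : Vol) (r : ℝ) (hr : 0 < r) (hra : r < a) (v : Vol) :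
    0 ≤ bump a r hr hra v := le_max_left _ _

theorem bump_le_one (a : Vol) (r : ℝ) (hr : 0 < r) (hra : r < a) (v : Vol) :
    bump a r hr hra v ≤ 1 := by
  refine max_le zero_le_one ?_
  have : 0 ≤ |(v : ℝ) - a| / r := by positivity
  linarith

theorem bump_self (a : Vol) (r : ℝ) (hr : 0 < r) (hra : r < a) : bump a r hr hra a = 1 := by
  simp [bump_apply]

theorem bump_eq_zero (a : Vol) (r : ℝ) (hr : 0 < r) (hra : r < a) (v : Vol)
    (hv : r ≤ |(v : ℝ) - a|) : bump a r hr hra v = 0 := by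
  refine max_eq_left ?_
  rw [sub_nonpos, le_div_iff₀ hr, one_mul]
  exact hv

/-! ### Flows of measures -/

/-- A vaguely continuous family of measures on `(0, ∞)`, indexed by all real times, whose moments
of orders `0` and `γ` are bounded by `C`. -/
structure IsBoundedFlow (γ : ℝ) (C : ℝ≥0) (f : ℝ → Measure Vol) : Prop where
  continuous : ∀ φ : C_c(Vol, ℝ), Continuous fun t => ∫ v, φ v ∂(f t)
  moment_bound : ∀ t, ∫⁻ v : Vol, ENNReal.ofReal (1 + (v : ℝ) ^ γ) ∂(f t) ≤ C

namespace IsBoundedFlow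

variable {γ : ℝ} {C : ℝ≥0} {f : ℝ → Measure Vol}

theorem measurable_rpow_vol (γ : ℝ) : Measurable fun v : Vol => (v : ℝ) ^ γ := by fun_prop

theorem measure_univ_le (hf : IsBoundedFlow γ C f) (t : ℝ) : f t univ ≤ C := by
  refine le_trans ?_ (hf.moment_bound t)
  rw [← lintegral_one]
  refine lintegral_mono fun v => ?_
  have hv := v.2
  have : 0 ≤ (v : ℝ) ^ γ := by positivity
  exact ENNReal.one_le_ofReal.2 (by linarith)

theorem isFiniteMeasure (hf : IsBoundedFlow γ C f) (t : ℝ) : IsFiniteMeasure (f t) :=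
  ⟨(hf.measure_univ_le t).trans_lt ENNReal.coe_lt_top⟩

theorem integrable_one_add_rpow (hf : IsBoundedFlow γ C f) (t : ℝ) :
    Integrable (fun v : Vol => 1 + (v : ℝ) ^ γ) (f t) := by
  refine ⟨((measurable_rpow_vol γ).const_add 1).aestronglyMeasurable, ?_⟩
  rw [hasFiniteIntegral_iff_ofReal]
  · exact (hf.moment_bound t).trans_lt ENNReal.coe_lt_top
  · refine Eventually.of_forall fun v => ?_
    have hv := v.2
    positivity

theorem integral_one_add_rpow_le (hf : IsBoundedFlow γ C f) (t : ℝ) :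
    ∫ v : Vol, (1 + (v : ℝ) ^ γ) ∂(f t) ≤ C := by
  rw [integral_eq_lintegral_of_nonneg_ae]
  · exact ENNReal.toReal_le_of_le_ofReal C.2 (by simpa using hf.moment_bound t)
  · refine Eventually.of_forall fun v => ?_
    have hv := v.2
    positivity
  · exact ((measurable_rpow_vol γ).const_add 1).aestronglyMeasurable

theorem integrable_rpow (hf : IsBoundedFlow γ C f) (t : ℝ) :
    Integrable (fun v : Vol => (v : ℝ) ^ γ) (f t) := by
  have := hf.isFiniteMeasure t
  simpa [Pi.sub_def] using (hf.integrable_one_add_rpow t).sub (integrable_const (1 : ℝ))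

theorem integrable_of_le (hf : IsBoundedFlow γ C f) (t : ℝ) {φ : Vol → ℝ} (hφ : Continuous φ)
    {A : ℝ} (hA : ∀ v : Vol, |φ v| ≤ A * (1 + (v : ℝ) ^ γ)) : Integrable φ (f t) :=
  ((hf.integrable_one_add_rpow t).const_mul A).mono' hφ.aestronglyMeasurable
    (Eventually.of_forall hA)

theorem integrable_of_bounded (hf : IsBoundedFlow γ C f) (t : ℝ) {φ : Vol → ℝ} (hφ : Continuous φ)
    {B : ℝ} (hB : ∀ v : Vol, |φ v| ≤ B) : Integrable φ (f t) := by
  have := hf.isFiniteMeasure t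
  exact (integrable_const B).mono' hφ.aestronglyMeasurable (Eventually.of_forall hB)

theorem le_one_add_rpow (hγ : 1 < γ) (v : Vol) : (v : ℝ) ≤ 1 + (v : ℝ) ^ γ := by
  have hv := v.2
  rcases le_total (v : ℝ) 1 with h | h
  · have : 0 ≤ (v : ℝ) ^ γ := by positivity
    linarith
  · have := Real.self_le_rpow_of_one_le h hγ.le
    linarith

theorem integrable_vol (hf : IsBoundedFlow γ C f) (hγ : 1 < γ) (t : ℝ) :
    Integrable (fun v : Vol => (v : ℝ)) (f t) :=
  hf.integrable_of_le t (A := 1) (by fun_prop) fun v => by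
    rw [abs_of_pos v.2, one_mul]
    exact le_one_add_rpow hγ v

theorem integral_const_le (hf : IsBoundedFlow γ C f) (t : ℝ) {φ : Vol → ℝ} {B : ℝ} (hB0 : 0 ≤ B)
    (hB : ∀ v : Vol, |φ v| ≤ B) : |∫ v, φ v ∂(f t)| ≤ B * C := by
  have := hf.isFiniteMeasure t
  refine (norm_integral_le_of_norm_le_const (f := φ) (C := B) (Eventually.of_forall hB)).trans ?_
  refine mul_le_mul_of_nonneg_left ?_ hB0
  exact ENNReal.toReal_le_of_le_ofReal C.2 (by simpa using hf.measure_univ_le t)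

/-- A continuous bounded function has pairings with the flow that are limits of pairings with
compactly supported functions. -/
theorem tendsto_integral_cutoffMul (hf : IsBoundedFlow γ C f) (t : ℝ) {φ : Vol → ℝ}
    (hφ : Continuous φ) {B : ℝ} (hB : ∀ v : Vol, |φ v| ≤ B) :
    Tendsto (fun n => ∫ v, cutoffMul φ hφ n v ∂(f t)) atTop (𝓝 (∫ v, φ v ∂(f t))) := by
  have := hf.isFiniteMeasure t
  refine tendsto_integral_of_dominated_convergence (fun _ => B) (fun n => ?_)
    (integrable_const B) (fun n => ?_) ?_
  · exact (cutoffMul φ hφ n).continuous.aestronglyMeasurable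
  · exact Eventually.of_forall fun v => (abs_cutoffMul_le φ hφ n v).trans (hB v)
  · exact Eventually.of_forall fun v => tendsto_cutoffMul φ hφ v

theorem measurable_integral (hf : IsBoundedFlow γ C f) {φ : Vol → ℝ}
    (hφ : Continuous φ) {B : ℝ} (hB : ∀ v : Vol, |φ v| ≤ B) :
    Measurable fun t => ∫ v, φ v ∂(f t) :=
  measurable_of_tendsto_metrizable (fun n => (hf.continuous (cutoffMul φ hφ n)).measurable)
    (tendsto_pi_nhds.2 fun t => hf.tendsto_integral_cutoffMul t hφ hB)

/-- Measures of closed sets are limits of pairings with thickened indicators, and closed sets form a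
generating π-system. This makes the flow a transition kernel, whence the collision integral is
measurable in time. -/
theorem measurable (hf : IsBoundedFlow γ C f) : Measurable f := by
  have hfin := hf.isFiniteMeasure
  have hclosed : ∀ F : Set Vol, IsClosed F → Measurable fun t => f t F := by
    intro F hF
    have hpos : ∀ n : ℕ, (0 : ℝ) < 1 / ((n : ℝ) + 1) := fun n => by positivity
    refine measurable_of_tendsto_metrizable
      (f := fun (n : ℕ) (t : ℝ) => ∫⁻ v, (thickenedIndicator (hpos n) F v : ℝ≥0∞) ∂(f t))
      (fun n => ?_) (tendsto_pi_nhds.2 fun t => tendsto_lintegral_thickenedIndicator_of_isClosed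
        (f t) hF hpos tendsto_one_div_add_atTop_nhds_zero_nat)
    have hcont : Continuous fun v : Vol => (thickenedIndicator (hpos n) F v : ℝ) :=
      NNReal.continuous_coe.comp (thickenedIndicator (hpos n) F).continuous
    have hle : ∀ v : Vol, |(thickenedIndicator (hpos n) F v : ℝ)| ≤ 1 := fun v => by
      rw [abs_of_nonneg (NNReal.coe_nonneg _)]
      exact_mod_cast thickenedIndicator_le_one (hpos n) F v
    have heq : (fun t => ∫⁻ v, (thickenedIndicator (hpos n) F v : ℝ≥0∞) ∂(f t)) =
        fun t => ENNReal.ofReal (∫ v, (thickenedIndicator (hpos n) F v : ℝ) ∂(f t)) := by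
      funext t
      rw [ofReal_integral_eq_lintegral_ofReal (hf.integrable_of_bounded t hcont hle)
        (Eventually.of_forall fun v => NNReal.coe_nonneg _)]
      simp
    rw [heq]
    exact (hf.measurable_integral hcont hle).ennreal_ofReal
  refine Measurable.measure_of_isPiSystem (S := {s : Set Vol | IsClosed s}) ?_ ?_
    (fun s hs => hclosed s hs) (hclosed univ isClosed_univ)
  · rw [← borel_eq_generateFrom_isClosed]
    exact BorelSpace.measurable_eq
  · exact isPiSystem_isClosed

/-- The flow as a transition kernel from times to volumes. -/
noncomputable def toKernel (hf : IsBoundedFlow γ C f) : Kernel ℝ Vol := ⟨f, hf.measurable⟩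

theorem toKernel_apply (hf : IsBoundedFlow γ C f) (t : ℝ) : hf.toKernel t = f t := rfl

instance (hf : IsBoundedFlow γ C f) : IsFiniteKernel hf.toKernel :=
  ⟨⟨C, ENNReal.coe_lt_top, fun t => hf.measure_univ_le t⟩⟩

theorem stronglyMeasurable_integral_prod (hf : IsBoundedFlow γ C f) {F : Vol × Vol → ℝ}
    (hF : Continuous F) : StronglyMeasurable fun t => ∫ p, F p ∂((f t).prod (f t)) := by
  have h := StronglyMeasurable.integral_kernel_prod_right'
    (κ := hf.toKernel.prod hf.toKernel) (f := fun q : ℝ × (Vol × Vol) => F q.2)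
    (hF.comp continuous_snd).stronglyMeasurable
  simpa only [Kernel.prod_apply, toKernel_apply] using h

end IsBoundedFlow

/-! ### The collision integral -/

/-- The collision integral `∫∫ K Θ_φ f f` at time `t`. -/
noncomputable def collision (K : ℝ → ℝ → ℝ) (f : ℝ → Measure Vol) (φ : Vol → ℝ) (t : ℝ) : ℝ :=
  ∫ p : Vol × Vol, K p.1 p.2 * Theta φ p.1 p.2 ∂((f t).prod (f t))

theorem continuous_theta {φ : Vol → ℝ} (hφ : Continuous φ) :
    Continuous fun p : Vol × Vol => Theta φ p.1 p.2 := by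
  unfold Theta
  have : Continuous fun p : Vol × Vol => p.1 + p.2 :=
    Continuous.subtype_mk (by fun_prop) _
  fun_prop

/-- Collisions preserve volume, so `Theta` ignores linear parts. A test function thus needs to be
bounded only up to a linear function. -/
theorem theta_sub_linear (φ : Vol → ℝ) (a : ℝ) (v v' : Vol) :
    Theta (fun v => φ v - a * v) v v' = Theta φ v v' := by
  simp only [Theta, Positive.coe_add]
  ring

theorem abs_theta_le {φ : Vol → ℝ} {a B : ℝ} (hB : ∀ v : Vol, |φ v - a * v| ≤ B) (v v' : Vol) :
    |Theta φ v v'| ≤ 3 * B := by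
  rw [← theta_sub_linear φ a, Theta]
  have h1 := abs_le.1 (hB (v + v'))
  have h2 := abs_le.1 (hB v)
  have h3 := abs_le.1 (hB v')
  rw [abs_le]
  constructor <;> linarith [h1.1, h1.2, h2.1, h2.2, h3.1, h3.2]

namespace IsBoundedFlow

variable {γ : ℝ} {C : ℝ≥0} {f : ℝ → Measure Vol}

theorem integrable_prod (hf : IsBoundedFlow γ C f) (t : ℝ) {F : Vol × Vol → ℝ}
    (hF : Continuous F) {A : ℝ}
    (hA : ∀ p : Vol × Vol, |F p| ≤ A * ((1 + (p.1 : ℝ) ^ γ) * (1 + (p.2 : ℝ) ^ γ))) :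
    Integrable F ((f t).prod (f t)) := by
  have := hf.isFiniteMeasure t
  exact (((hf.integrable_one_add_rpow t).mul_prod (hf.integrable_one_add_rpow t)).const_mul A).mono'
    hF.aestronglyMeasurable (Eventually.of_forall hA)

theorem abs_integral_prod_le (hf : IsBoundedFlow γ C f) (t : ℝ) {F : Vol × Vol → ℝ}
    {A : ℝ} (hA0 : 0 ≤ A)
    (hA : ∀ p : Vol × Vol, |F p| ≤ A * ((1 + (p.1 : ℝ) ^ γ) * (1 + (p.2 : ℝ) ^ γ))) :
    |∫ p, F p ∂((f t).prod (f t))| ≤ A * (C * C) := by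
  have := hf.isFiniteMeasure t
  refine (norm_integral_le_of_norm_le (f := F) (((hf.integrable_one_add_rpow t).mul_prod
    (hf.integrable_one_add_rpow t)).const_mul A) (Eventually.of_forall hA)).trans ?_
  rw [integral_const_mul,
    integral_prod_mul (fun v : Vol => 1 + (v : ℝ) ^ γ) (fun v : Vol => 1 + (v : ℝ) ^ γ)]
  refine mul_le_mul_of_nonneg_left ?_ hA0
  have h := hf.integral_one_add_rpow_le t
  refine mul_le_mul h h (integral_nonneg fun v => ?_) C.2
  have hv := v.2
  simp only [Pi.zero_apply]
  positivity

end IsBoundedFlow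

/-- A kernel that is continuous, nonnegative and bounded by `Λ (v ^ γ + v' ^ γ)`. -/
structure IsBoundedKernel (γ Λ : ℝ) (K : ℝ → ℝ → ℝ) : Prop where
  continuous : Continuous fun p : Vol × Vol => K p.1 p.2
  nonneg : ∀ v v' : Vol, 0 ≤ K v v'
  const_nonneg : 0 ≤ Λ
  le : ∀ v v' : Vol, K v v' ≤ Λ * ((v : ℝ) ^ γ + (v' : ℝ) ^ γ)

theorem KernelAssumption.exists_isBoundedKernel {γ : ℝ} {K : ℝ → ℝ → ℝ}
    (hK : KernelAssumption γ K) : ∃ Λ, IsBoundedKernel γ Λ K := by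
  obtain ⟨Λ, hΛ, hle⟩ := hK.exists_upper_bound
  exact ⟨Λ, hK.continuous_vol, fun v v' => hK.nonneg _ _ v.2.le v'.2.le, hΛ, hle⟩

section

variable {γ Λ : ℝ} {C : ℝ≥0} {K : ℝ → ℝ → ℝ} {f : ℝ → Measure Vol}

theorem IsBoundedKernel.abs_mul_le (hK : IsBoundedKernel γ Λ K) {x B : ℝ} (hx : |x| ≤ B)
    (p : Vol × Vol) :
    |K p.1 p.2 * x| ≤ Λ * B * ((1 + (p.1 : ℝ) ^ γ) * (1 + (p.2 : ℝ) ^ γ)) := by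
  have hv := p.1.2
  have hv' := p.2.2
  have h1 : 0 ≤ (p.1 : ℝ) ^ γ := by positivity
  have h2 : 0 ≤ (p.2 : ℝ) ^ γ := by positivity
  have hΛ := hK.const_nonneg
  have hB : 0 ≤ B := (abs_nonneg x).trans hx
  rw [abs_mul, abs_of_nonneg (hK.nonneg _ _)]
  calc K p.1 p.2 * |x| ≤ Λ * ((p.1 : ℝ) ^ γ + (p.2 : ℝ) ^ γ) * B :=
        mul_le_mul (hK.le _ _) hx (abs_nonneg _) (by positivity)
    _ = Λ * B * ((p.1 : ℝ) ^ γ + (p.2 : ℝ) ^ γ) := by ring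
    _ ≤ _ := mul_le_mul_of_nonneg_left (by nlinarith [mul_nonneg h1 h2]) (by positivity)

theorem continuous_kernel_mul_theta (hK : IsBoundedKernel γ Λ K) {φ : Vol → ℝ}
    (hφ : Continuous φ) : Continuous fun p : Vol × Vol => K p.1 p.2 * Theta φ p.1 p.2 :=
  hK.continuous.mul (continuous_theta hφ)

theorem integrable_kernel_mul_theta (hK : IsBoundedKernel γ Λ K) (hf : IsBoundedFlow γ C f)
    {φ : Vol → ℝ} (hφ : Continuous φ) {a B : ℝ} (hB : ∀ v : Vol, |φ v - a * v| ≤ B) (t : ℝ) :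
    Integrable (fun p : Vol × Vol => K p.1 p.2 * Theta φ p.1 p.2) ((f t).prod (f t)) :=
  hf.integrable_prod t (continuous_kernel_mul_theta hK hφ)
    fun p => hK.abs_mul_le (abs_theta_le hB p.1 p.2) p

theorem abs_collision_le (hK : IsBoundedKernel γ Λ K) (hf : IsBoundedFlow γ C f)
    {φ : Vol → ℝ} {a B : ℝ} (hB : ∀ v : Vol, |φ v - a * v| ≤ B) (t : ℝ) :
    |collision K f φ t| ≤ Λ * (3 * B) * (C * C) := by
  have hB0 : 0 ≤ B := (abs_nonneg _).trans (hB ⟨1, one_pos⟩)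
  have hΛ := hK.const_nonneg
  exact hf.abs_integral_prod_le t (by positivity)
    fun p => hK.abs_mul_le (abs_theta_le hB p.1 p.2) p

theorem stronglyMeasurable_collision (hK : IsBoundedKernel γ Λ K) (hf : IsBoundedFlow γ C f)
    {φ : Vol → ℝ} (hφ : Continuous φ) : StronglyMeasurable (collision K f φ) :=
  hf.stronglyMeasurable_integral_prod (continuous_kernel_mul_theta hK hφ)

theorem intervalIntegrable_of_bounded {u : ℝ → ℝ} (hu : StronglyMeasurable u) {B : ℝ}
    (hB : ∀ t, |u t| ≤ B) (s t : ℝ) : IntervalIntegrable u volume s t :=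
  intervalIntegrable_iff.2 <| (integrableOn_const (by simp) (C := B)).mono'
    hu.aestronglyMeasurable (Eventually.of_forall hB)

theorem intervalIntegrable_collision (hK : IsBoundedKernel γ Λ K) (hf : IsBoundedFlow γ C f)
    {φ : Vol → ℝ} (hφ : Continuous φ) {a B : ℝ} (hB : ∀ v : Vol, |φ v - a * v| ≤ B) (s t : ℝ) :
    IntervalIntegrable (collision K f φ) volume s t :=
  intervalIntegrable_of_bounded (stronglyMeasurable_collision hK hf hφ)
    (abs_collision_le hK hf hB) s t

theorem tendsto_collision_cutoffMul (hK : IsBoundedKernel γ Λ K) (hf : IsBoundedFlow γ C f)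
    {φ : Vol → ℝ} (hφ : Continuous φ) {B : ℝ} (hB : ∀ v : Vol, |φ v| ≤ B) (t : ℝ) :
    Tendsto (fun n => collision K f (cutoffMul φ hφ n) t) atTop (𝓝 (collision K f φ t)) := by
  have := hf.isFiniteMeasure t
  refine tendsto_integral_of_dominated_convergence
    (fun p => Λ * (3 * B) * ((1 + (p.1 : ℝ) ^ γ) * (1 + (p.2 : ℝ) ^ γ))) (fun n => ?_)
    (((hf.integrable_one_add_rpow t).mul_prod (hf.integrable_one_add_rpow t)).const_mul _)
    (fun n => ?_) ?_
  · exact (continuous_kernel_mul_theta hK (cutoffMul φ hφ n).continuous).aestronglyMeasurable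
  · refine Eventually.of_forall fun p => hK.abs_mul_le (abs_theta_le (a := 0) (fun v => ?_) _ _) p
    rw [zero_mul, sub_zero]
    exact (abs_cutoffMul_le φ hφ n v).trans (hB v)
  · refine Eventually.of_forall fun p => Tendsto.const_mul _ ?_
    exact ((tendsto_cutoffMul φ hφ _).sub (tendsto_cutoffMul φ hφ _)).sub
      (tendsto_cutoffMul φ hφ _)

end

/-! ### Mass-conserving flows -/

/-- A bounded flow that satisfies the weak coagulation equation on `[0, T]`, `T` finite, and
conserves mass. -/
structure IsConservativeFlow (γ : ℝ) (K : ℝ → ℝ → ℝ) (T : ℝ) (C : ℝ≥0)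
    (f : ℝ → Measure Vol) : Prop extends IsBoundedFlow γ C f where
  weak_eq : ∀ φ : C_c(Vol, ℝ), ∀ t ∈ Icc 0 T,
    ∫ v, φ v ∂(f t) - ∫ v, φ v ∂(f 0) = 1 / 2 * ∫ s in (0 : ℝ)..t, collision K f φ s
  mass : ∀ t, ∫ v : Vol, (v : ℝ) ∂(f t) = ∫ v : Vol, (v : ℝ) ∂(f 0)

namespace IsConservativeFlow

variable {γ Λ T : ℝ} {C : ℝ≥0} {K : ℝ → ℝ → ℝ} {f : ℝ → Measure Vol}

/-- Cutoffs pass to the limit by dominated convergence, first in the volumes and then in time; the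
growth of `K` is absorbed by the moments of orders `0` and `γ`. -/
theorem weak_eq_of_bounded (hf : IsConservativeFlow γ K T C f) (hK : IsBoundedKernel γ Λ K)
    {φ : Vol → ℝ} (hφ : Continuous φ) {B : ℝ} (hB : ∀ v : Vol, |φ v| ≤ B) {t : ℝ}
    (ht : t ∈ Icc 0 T) :
    ∫ v, φ v ∂(f t) - ∫ v, φ v ∂(f 0) = 1 / 2 * ∫ s in (0 : ℝ)..t, collision K f φ s := by
  have hb := hf.toIsBoundedFlow
  refine tendsto_nhds_unique (((hb.tendsto_integral_cutoffMul t hφ hB).sub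
    (hb.tendsto_integral_cutoffMul 0 hφ hB)).congr fun n => hf.weak_eq _ t ht)
    (Tendsto.const_mul _ ?_)
  refine intervalIntegral.tendsto_integral_filter_of_dominated_convergence
    (fun _ => Λ * (3 * B) * (C * C)) (Eventually.of_forall fun n => ?_)
    (Eventually.of_forall fun n => Eventually.of_forall fun s _ => ?_)
    intervalIntegrable_const (Eventually.of_forall fun s _ => ?_)
  · exact (stronglyMeasurable_collision hK hb
      (cutoffMul φ hφ n).continuous).aestronglyMeasurable
  · refine abs_collision_le (a := 0) hK hb (fun v => ?_) s
    rw [zero_mul, sub_zero]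
    exact (abs_cutoffMul_le φ hφ n v).trans (hB v)
  · exact tendsto_collision_cutoffMul hK hb hφ hB s

theorem integrable_test (hf : IsBoundedFlow γ C f) (hγ : 1 < γ) {φ : Vol → ℝ}
    (hφ : Continuous φ) {a B : ℝ} (hB : ∀ v : Vol, |φ v - a * v| ≤ B) (t : ℝ) :
    Integrable φ (f t) := by
  have h1 := (hf.integrable_of_bounded t (φ := fun v => φ v - a * v) (by fun_prop) hB).add
    ((hf.integrable_vol hγ t).const_mul a)
  simpa [Pi.add_def] using h1

/-- The weak equation between two times, for test functions at bounded distance from a linear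
function. -/
theorem weak_eq_test (hf : IsConservativeFlow γ K T C f) (hγ : 1 < γ)
    (hK : IsBoundedKernel γ Λ K) {φ : Vol → ℝ} (hφ : Continuous φ) {a B : ℝ}
    (hB : ∀ v : Vol, |φ v - a * v| ≤ B) {s t : ℝ} (hs : s ∈ Icc 0 T) (ht : t ∈ Icc 0 T) :
    ∫ v, φ v ∂(f t) - ∫ v, φ v ∂(f s) = 1 / 2 * ∫ r in s..t, collision K f φ r := by
  have hb := hf.toIsBoundedFlow
  have hcont : Continuous fun v : Vol => φ v - a * v := by fun_prop
  have key : ∀ r ∈ Icc 0 T, ∫ v, φ v ∂(f r) - ∫ v, φ v ∂(f 0) =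
      1 / 2 * ∫ s in (0 : ℝ)..r, collision K f φ s := by
    intro r hr
    -- Here mass conservation is used: the linear part contributes the same amount at all times, so
    -- it cancels in the difference.
    have hsplit : ∀ r, ∫ v, (φ v - a * v) ∂(f r) = ∫ v, φ v ∂(f r) - a * ∫ v : Vol, (v : ℝ) ∂(f 0) :=
      fun r => by
        rw [integral_sub (integrable_test hb hγ hφ hB r) ((hb.integrable_vol hγ r).const_mul a),
          integral_const_mul, hf.mass r]
    have h := hf.weak_eq_of_bounded hK hcont hB hr
    have hcol : collision K f (fun v => φ v - a * v) = collision K f φ := by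
      funext r
      simp only [collision, theta_sub_linear]
    rw [hsplit, hsplit, hcol] at h
    linarith
  have hint := fun r => intervalIntegrable_collision hK hb hφ hB 0 r
  rw [← intervalIntegral.integral_interval_sub_left (hint t) (hint s), mul_sub, ← key t ht,
    ← key s hs]
  ring

/-- Pairings with bounded test functions are Lipschitz in time. -/
theorem abs_integral_sub_le (hf : IsConservativeFlow γ K T C f) (hγ : 1 < γ)
    (hK : IsBoundedKernel γ Λ K) {φ : Vol → ℝ} (hφ : Continuous φ) {B : ℝ}
    (hB : ∀ v : Vol, |φ v| ≤ B) {s t : ℝ} (hs : s ∈ Icc 0 T) (ht : t ∈ Icc 0 T) :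
    |∫ v, φ v ∂(f t) - ∫ v, φ v ∂(f s)| ≤ Λ * (3 * B) * (C * C) * |t - s| := by
  have hB' : ∀ v : Vol, |φ v - 0 * v| ≤ B := by simpa using hB
  rw [hf.weak_eq_test hγ hK hφ hB' hs ht, abs_mul]
  have h := intervalIntegral.norm_integral_le_of_norm_le_const (a := s) (b := t)
    (f := collision K f φ) (C := Λ * (3 * B) * (C * C))
    fun r _ => abs_collision_le hK hf.toIsBoundedFlow hB' r
  rw [Real.norm_eq_abs] at h
  have h12 : |(1 / 2 : ℝ)| = 1 / 2 := abs_of_pos (by norm_num)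
  rw [h12]
  linarith [abs_nonneg (∫ r in s..t, collision K f φ r)]

end IsConservativeFlow

/-! ### A convex function that is affine at infinity -/

/-- The derivative of `softPos`. -/
noncomputable def ramp (x : ℝ) : ℝ := min (max x 0) 1

/-- A `C¹` convex approximation of the positive part: `x² / 2` on `[0, 1]`, `x - 1 / 2` above. -/
noncomputable def softPos (x : ℝ) : ℝ := ramp x * x - ramp x ^ 2 / 2

theorem continuous_ramp : Continuous ramp := by unfold ramp; fun_prop

theorem continuous_softPos : Continuous softPos := by
  have := continuous_ramp
  unfold softPos
  fun_prop

theorem ramp_cases (x : ℝ) :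
    (x ≤ 0 ∧ ramp x = 0) ∨ (0 ≤ x ∧ x ≤ 1 ∧ ramp x = x) ∨ (1 ≤ x ∧ ramp x = 1) := by
  unfold ramp
  rcases le_total x 0 with h | h
  · left; simp [h]
  · rcases le_total x 1 with h1 | h1
    · right; left; simp [h, h1]
    · right; right; simp [h, h1]

theorem ramp_nonneg (x : ℝ) : 0 ≤ ramp x := le_min (le_max_right _ _) zero_le_one

theorem ramp_le_one (x : ℝ) : ramp x ≤ 1 := min_le_right _ _

theorem ramp_monotone : Monotone ramp := fun _ _ h =>
  min_le_min_right _ (max_le_max_right _ h)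

theorem ramp_le_add (x : ℝ) {h : ℝ} (hh : 0 ≤ h) : ramp x ≤ ramp (x - h) + h := by
  rcases ramp_cases x with ⟨_, hx⟩ | ⟨_, _, hx⟩ | ⟨_, hx⟩ <;>
  rcases ramp_cases (x - h) with ⟨_, hy⟩ | ⟨_, _, hy⟩ | ⟨_, hy⟩ <;>
  rw [hx, hy] <;> linarith

/-- The tangent line inequality of a convex function with derivative `ramp`. -/
theorem softPos_add_mul_le (x y : ℝ) : softPos x + (y - x) * ramp x ≤ softPos y := by
  unfold softPos
  rcases ramp_cases x with ⟨_, hx⟩ | ⟨_, _, hx⟩ | ⟨_, hx⟩ <;>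
  rcases ramp_cases y with ⟨_, hy⟩ | ⟨_, _, hy⟩ | ⟨_, hy⟩ <;>
  rw [hx, hy] <;> nlinarith [sq_nonneg (x - y), sq_nonneg (x - 1), sq_nonneg (y - 1)]

theorem softPos_of_nonpos {x : ℝ} (h : x ≤ 0) : softPos x = 0 := by
  simp [softPos, ramp, h]

theorem softPos_nonneg (x : ℝ) : 0 ≤ softPos x := by
  have h := softPos_add_mul_le 0 x
  simpa [softPos, ramp] using h

theorem softPos_pos {x : ℝ} (h : 0 < x) : 0 < softPos x := by
  unfold softPos
  rcases ramp_cases x with ⟨_, hx⟩ | ⟨_, _, hx⟩ | ⟨_, hx⟩ <;> rw [hx] <;> nlinarith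

theorem softPos_le_mul_ramp (x : ℝ) : softPos x ≤ x * ramp x := by
  have := sq_nonneg (ramp x)
  unfold softPos
  linarith

theorem softPos_le {x : ℝ} (h : 0 ≤ x) : softPos x ≤ x :=
  (softPos_le_mul_ramp x).trans (mul_le_of_le_one_right h (ramp_le_one x))

theorem sub_half_le_softPos (x : ℝ) : x - 1 / 2 ≤ softPos x := by
  have h := softPos_add_mul_le 1 x
  simp [softPos, ramp] at h
  unfold softPos ramp
  linarith

/-- This makes the excess an admissible test function in `weak_eq_test`, with slope `a = 1`. -/
theorem abs_softPos_sub_le {y : ℝ} (hy : 0 ≤ y) (v : Vol) :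
    |softPos ((v : ℝ) - y) - 1 * v| ≤ y + 1 := by
  have hv := v.2
  have h1 := sub_half_le_softPos ((v : ℝ) - y)
  have h2 : softPos ((v : ℝ) - y) ≤ v := by
    rcases le_total ((v : ℝ) - y) 0 with h | h
    · rw [softPos_of_nonpos h]
      exact hv.le
    · exact (softPos_le h).trans (by linarith)
  rw [abs_le]
  constructor <;> linarith

/-- For `b ≤ a`, the tangent at `a - y` yields a gain of at least `b * ramp (a - y)`, which
dominates `softPos (b - y)` because `ramp` is monotone. Hence every collision contributes
nonnegatively to the excess. -/
theorem softPos_superadditive {a b y : ℝ} (ha : 0 ≤ a) (hb : 0 ≤ b) (hy : 0 ≤ y) :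
    softPos (a - y) + softPos (b - y) ≤ softPos (a + b - y) := by
  wlog hab : b ≤ a generalizing a b
  · have := this hb ha (le_of_not_ge hab)
    rw [add_comm b a] at this
    linarith
  have h1 := softPos_add_mul_le (a - y) (a + b - y)
  have h2 : softPos (b - y) ≤ b * ramp (a - y) := by
    rcases le_total (b - y) 0 with h | h
    · rw [softPos_of_nonpos h]
      exact mul_nonneg hb (ramp_nonneg _)
    · refine (softPos_le_mul_ramp _).trans ?_
      exact mul_le_mul (by linarith) (ramp_monotone (by linarith)) (ramp_nonneg _) hb
  have h3 : a + b - y - (a - y) = b := by ring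
  rw [h3] at h1
  linarith

/-! ### Mass transport to infinity -/

section

variable {γ Λ T : ℝ} {C : ℝ≥0} {K : ℝ → ℝ → ℝ} {f : ℝ → Measure Vol}

/-- A smoothed excess mass above the volume `y`. -/
noncomputable def excess (f : ℝ → Measure Vol) (y t : ℝ) : ℝ :=
  ∫ v : Vol, softPos ((v : ℝ) - y) ∂(f t)

/-- A smoothed number of particles above the volume `y`. -/
noncomputable def tailCount (f : ℝ → Measure Vol) (y t : ℝ) : ℝ :=
  ∫ v : Vol, ramp ((v : ℝ) - y) ∂(f t)

theorem continuous_ramp_sub (y : ℝ) : Continuous fun v : Vol => ramp ((v : ℝ) - y) :=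
  continuous_ramp.comp (by fun_prop)

theorem continuous_softPos_sub (y : ℝ) : Continuous fun v : Vol => softPos ((v : ℝ) - y) :=
  continuous_softPos.comp (by fun_prop)

theorem abs_ramp_le_one (x : ℝ) : |ramp x| ≤ 1 := by
  rw [abs_of_nonneg (ramp_nonneg x)]
  exact ramp_le_one x

namespace IsBoundedFlow

theorem integrable_ramp (hf : IsBoundedFlow γ C f) (y t : ℝ) :
    Integrable (fun v : Vol => ramp ((v : ℝ) - y)) (f t) :=
  hf.integrable_of_bounded t (continuous_ramp_sub y) fun _ => abs_ramp_le_one _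

theorem integrable_softPos (hf : IsBoundedFlow γ C f) (hγ : 1 < γ) {y : ℝ} (hy : 0 ≤ y) (t : ℝ) :
    Integrable (fun v : Vol => softPos ((v : ℝ) - y)) (f t) :=
  IsConservativeFlow.integrable_test hf hγ (continuous_softPos_sub y) (abs_softPos_sub_le hy) t

/-- An integrated tangent inequality: the one-sided discrete form of `∂_y E = -N`. -/
theorem excess_sub_le (hf : IsBoundedFlow γ C f) (hγ : 1 < γ) {y h : ℝ} (hy : 0 ≤ y) (hh : 0 ≤ h)
    (t : ℝ) : excess f y t - h * tailCount f y t ≤ excess f (y + h) t := by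
  rw [excess, tailCount, ← integral_const_mul, ← integral_sub (hf.integrable_softPos hγ hy t)
    ((hf.integrable_ramp y t).const_mul h)]
  refine integral_mono ((hf.integrable_softPos hγ hy t).sub
    ((hf.integrable_ramp y t).const_mul h)) (hf.integrable_softPos hγ (by linarith) t) fun v => ?_
  have := softPos_add_mul_le ((v : ℝ) - y) ((v : ℝ) - (y + h))
  simp only
  linarith

theorem tailCount_sub_le (hf : IsBoundedFlow γ C f) (y : ℝ) {h : ℝ} (hh : 0 ≤ h) (t : ℝ) :
    tailCount f y t - h * C ≤ tailCount f (y + h) t := by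
  have := hf.isFiniteMeasure t
  have h1 : tailCount f y t ≤ ∫ v : Vol, (ramp ((v : ℝ) - (y + h)) + h) ∂(f t) := by
    refine integral_mono (hf.integrable_ramp y t)
      ((hf.integrable_ramp (y + h) t).add (integrable_const h)) fun v => ?_
    have := ramp_le_add ((v : ℝ) - y) hh
    rw [sub_sub] at this
    exact this
  rw [integral_add (hf.integrable_ramp (y + h) t) (integrable_const h)] at h1
  have h2 := (le_abs_self _).trans
    (hf.integral_const_le t (φ := fun _ => h) hh fun _ => (abs_of_nonneg hh).le)
  unfold tailCount at *
  linarith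

/-- Above `y` one has `v ≤ y ^ (1 - γ) * v ^ γ`, so the moment bound controls the excess uniformly
in time. -/
theorem excess_le (hf : IsBoundedFlow γ C f) (hγ : 1 < γ) {y : ℝ} (hy : 0 < y) (t : ℝ) :
    excess f y t ≤ y ^ (1 - γ) * C := by
  have h1 : excess f y t ≤ ∫ v : Vol, y ^ (1 - γ) * (1 + (v : ℝ) ^ γ) ∂(f t) := by
    refine integral_mono (hf.integrable_softPos hγ hy.le t)
      ((hf.integrable_one_add_rpow t).const_mul _) fun v => ?_
    have hv := v.2
    simp only
    rcases le_total ((v : ℝ) - y) 0 with h | h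
    · rw [softPos_of_nonpos h]
      positivity
    · have h2 : (v : ℝ) ^ (1 - γ) ≤ y ^ (1 - γ) :=
        Real.rpow_le_rpow_of_nonpos hy (by linarith) (by linarith)
      have h3 : (v : ℝ) = (v : ℝ) ^ (1 - γ) * (v : ℝ) ^ γ := by
        rw [← Real.rpow_add hv, sub_add_cancel, Real.rpow_one]
      have h4 : 0 ≤ (v : ℝ) ^ γ := by positivity
      have h5 : 0 ≤ y ^ (1 - γ) := by positivity
      have h6 := softPos_le h
      have h7 := mul_le_mul_of_nonneg_right h2 h4
      nlinarith
  rw [integral_const_mul] at h1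
  exact h1.trans (mul_le_mul_of_nonneg_left (hf.integral_one_add_rpow_le t) (by positivity))

/-- All collisions contribute nonnegatively, so it suffices to keep those of `v ≥ y` with `v' ≤ R /
4`. There `K ≥ c R ^ γ` and the excess gains at least `ramp (v - y) * v'`. -/
theorem collision_excess_ge (hf : IsBoundedFlow γ C f) (hγ : 1 < γ) (hK : IsBoundedKernel γ Λ K)
    {H c : ℝ} (hc : 0 < c)
    (hlow : ∀ v v' : Vol, H ≤ v → (v' : ℝ) ≤ v / 4 → c * (v : ℝ) ^ γ ≤ K v v')
    {R y : ℝ} (hR : 0 < R) (hRH : H ≤ R) (hy : R ≤ y) {m t : ℝ}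
    (hm : m / 2 ≤ ∫ v : Vol, (v : ℝ) ∂(f t) - (R / 4) ^ (1 - γ) * C) :
    c * R ^ γ * (m / 2) * tailCount f y t ≤
      collision K f (fun v => softPos ((v : ℝ) - y)) t := by
  have := hf.isFiniteMeasure t
  -- The weight `v' - r * v' ^ γ` is at most `v'` and is nonpositive for `v' ≥ R / 4`. It replaces a
  -- sharp restriction to small partners and gives a product lower bound on the whole space.
  set r : ℝ := (R / 4) ^ (1 - γ) with hr
  have hr0 : 0 ≤ r := by positivity
  have hi : Integrable (fun v : Vol => (v : ℝ) - r * (v : ℝ) ^ γ) (f t) :=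
    (hf.integrable_vol hγ t).sub ((hf.integrable_rpow t).const_mul r)
  have hm' : m / 2 ≤ ∫ v : Vol, ((v : ℝ) - r * (v : ℝ) ^ γ) ∂(f t) := by
    rw [integral_sub (hf.integrable_vol hγ t) ((hf.integrable_rpow t).const_mul r),
      integral_const_mul]
    have h1 : ∫ v : Vol, (v : ℝ) ^ γ ∂(f t) ≤ C :=
      (integral_mono (hf.integrable_rpow t) (hf.integrable_one_add_rpow t)
        fun v => by simp).trans (hf.integral_one_add_rpow_le t)
    have := mul_le_mul_of_nonneg_left h1 hr0
    linarith
  have hprod : c * R ^ γ * (tailCount f y t * ∫ v : Vol, ((v : ℝ) - r * (v : ℝ) ^ γ) ∂(f t)) ≤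
      collision K f (fun v => softPos ((v : ℝ) - y)) t := by
    rw [tailCount, ← integral_prod_mul, ← integral_const_mul]
    refine integral_mono (((hf.integrable_ramp y t).mul_prod hi).const_mul _)
      (integrable_kernel_mul_theta hK hf (continuous_softPos_sub y)
        (abs_softPos_sub_le (hR.le.trans hy)) t) fun p => ?_
    obtain ⟨v, v'⟩ := p
    have hv := v.2
    have hv' := v'.2
    have hT : 0 ≤ Theta (fun v => softPos ((v : ℝ) - y)) v v' := by
      have := softPos_superadditive hv.le hv'.le (hR.le.trans hy)
      simp only [Theta, Positive.coe_add]
      linarith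
    have hcR : 0 ≤ c * R ^ γ := by positivity
    have hKT := mul_nonneg (hK.nonneg v v') hT
    simp only
    rcases le_total ((v : ℝ) - y) 0 with hvy | hvy
    · have : ramp ((v : ℝ) - y) = 0 := by simp [ramp, hvy]
      rw [this]
      simpa using hKT
    rcases le_total (v' : ℝ) (R / 4) with hv4 | hv4
    · have h1 : c * R ^ γ ≤ K v v' := by
        refine le_trans ?_ (hlow v v' (by linarith) (by linarith))
        gcongr
        linarith
      have h2 : ramp ((v : ℝ) - y) * ((v' : ℝ) - r * (v' : ℝ) ^ γ) ≤
          Theta (fun v => softPos ((v : ℝ) - y)) v v' := by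
        have h3 := softPos_add_mul_le ((v : ℝ) - y) ((v : ℝ) + v' - y)
        have h4 : softPos ((v' : ℝ) - y) = 0 := softPos_of_nonpos (by linarith)
        have h5 : 0 ≤ ramp ((v : ℝ) - y) * (r * (v' : ℝ) ^ γ) :=
          mul_nonneg (ramp_nonneg _) (by positivity)
        simp only [Theta, Positive.coe_add, h4]
        linarith
      exact (mul_le_mul_of_nonneg_left h2 hcR).trans (mul_le_mul_of_nonneg_right h1 hT)
    · refine le_trans ?_ hKT
      have h1 : (v' : ℝ) ≤ r * (v' : ℝ) ^ γ := by
        have h2 : (v' : ℝ) ^ (1 - γ) ≤ r :=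
          Real.rpow_le_rpow_of_nonpos (by positivity) hv4 (by linarith)
        calc (v' : ℝ) = (v' : ℝ) ^ (1 - γ) * (v' : ℝ) ^ γ := by
              rw [← Real.rpow_add hv', sub_add_cancel, Real.rpow_one]
          _ ≤ _ := mul_le_mul_of_nonneg_right h2 (by positivity)
      exact mul_nonpos_of_nonneg_of_nonpos hcR
        (mul_nonpos_of_nonneg_of_nonpos (ramp_nonneg _) (by linarith))
  refine le_trans ?_ hprod
  rw [mul_assoc, mul_comm (m / 2)]
  have h0 : 0 ≤ tailCount f y t := integral_nonneg fun v => ramp_nonneg _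
  gcongr

end IsBoundedFlow

/-- A function with at most quadratically small decrease on small intervals is monotone. -/
theorem le_of_sub_sq_le {G : ℝ → ℝ} {B Δ : ℝ} (hΔ : 0 ≤ Δ)
    (h : ∀ x ε : ℝ, 0 ≤ x → 0 ≤ ε → x + ε ≤ Δ → G x - B * ε ^ 2 ≤ G (x + ε)) :
    G 0 ≤ G Δ := by
  -- With `n + 1` equal steps the quadratic errors add up to `B * Δ ^ 2 / (n + 1)`.
  have key : ∀ n : ℕ, G 0 - B * Δ ^ 2 * (1 / ((n : ℝ) + 1)) ≤ G Δ := by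
    intro n
    set ε : ℝ := Δ / ((n : ℝ) + 1) with hε
    have hn : (0 : ℝ) < n + 1 := by positivity
    have hεΔ : ((n : ℝ) + 1) * ε = Δ := by rw [hε]; field_simp
    have hε0 : 0 ≤ ε := by positivity
    have hind : ∀ j : ℕ, j ≤ n + 1 → G 0 - j * (B * ε ^ 2) ≤ G (j * ε) := by
      intro j
      induction j with
      | zero => intro _; simp
      | succ j ih =>
        intro hj
        have hj' : (j : ℝ) + 1 ≤ n + 1 := by exact_mod_cast hj
        have h1 := ih (by omega)
        have h2 := h (j * ε) ε (by positivity) hε0 (by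
          rw [← hεΔ]
          nlinarith)
        have h3 : ((j + 1 : ℕ) : ℝ) * ε = j * ε + ε := by push_cast; ring
        rw [h3]
        push_cast
        linarith
    have h1 := hind (n + 1) le_rfl
    push_cast at h1
    rw [hεΔ] at h1
    have h2 : ((n : ℝ) + 1) * (B * ε ^ 2) = B * Δ ^ 2 * (1 / ((n : ℝ) + 1)) := by
      rw [hε]; field_simp
    linarith
  have hlim : Tendsto (fun n : ℕ => G 0 - B * Δ ^ 2 * (1 / ((n : ℝ) + 1))) atTop
      (𝓝 (G 0 - B * Δ ^ 2 * 0)) :=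
    tendsto_const_nhds.sub (tendsto_one_div_add_atTop_nhds_zero_nat.const_mul _)
  have := le_of_tendsto' hlim key
  linarith

namespace IsConservativeFlow

/-- Formally `d/dx E(R + q x, s + x) = -q N + ∂_t E ≥ 0`. No differentiation is needed: a short step
loses only a quadratic error, and `le_of_sub_sq_le` concludes. -/
theorem excess_advance (hf : IsConservativeFlow γ K T C f) (hγ : 1 < γ)
    (hK : IsBoundedKernel γ Λ K) {R q : ℝ} (hR : 0 ≤ R) (hq : 0 ≤ q)
    (hflux : ∀ y t, R ≤ y → 2 * q * tailCount f y t ≤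
      collision K f (fun v => softPos ((v : ℝ) - y)) t)
    {s Δ : ℝ} (hs : 0 ≤ s) (hΔ : 0 ≤ Δ) (hsΔ : s + Δ ≤ T) :
    excess f R s ≤ excess f (R + q * Δ) (s + Δ) := by
  have hb := hf.toIsBoundedFlow
  set L : ℝ := Λ * (3 * 1) * (C * C) with hL
  have hL0 : 0 ≤ L := by
    have := hK.const_nonneg
    positivity
  -- In `B`, the term `C * q` comes from the Lipschitz bound of `tailCount` in `y`, and `L` from the
  -- one in time.
  have hmain := le_of_sub_sq_le (G := fun x => excess f (R + q * x) (s + x))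
    (B := q * (C * q + L)) hΔ fun x ε hx hε hxε => ?_
  · simpa using hmain
  set y := R + q * x with hy
  set t := s + x with ht
  have hyR : R ≤ y := by have := mul_nonneg hq hx; linarith
  have hqε : 0 ≤ q * ε := mul_nonneg hq hε
  have htm : t ∈ Icc 0 T := ⟨by linarith, by linarith⟩
  have htm' : t + ε ∈ Icc 0 T := ⟨by linarith, by linarith⟩
  have e1 : R + q * (x + ε) = y + q * ε := by rw [hy]; ring
  have e2 : s + (x + ε) = t + ε := by rw [ht]; ring
  simp only [e1, e2]
  have hy' : 0 ≤ y + q * ε := by linarith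
  have h1 := hb.excess_sub_le hγ (hR.trans hyR) hqε t
  have h2 := hb.tailCount_sub_le y hqε t
  have h3 := hf.weak_eq_test hγ hK (continuous_softPos_sub (y + q * ε))
    (abs_softPos_sub_le hy') htm htm'
  have hint := intervalIntegrable_collision hK hb (continuous_softPos_sub (y + q * ε))
    (abs_softPos_sub_le hy') t (t + ε)
  have h4 : ∫ _ in t..t + ε, 2 * q * (tailCount f (y + q * ε) t - L * ε) ≤
      ∫ r in t..t + ε, collision K f (fun v => softPos ((v : ℝ) - (y + q * ε))) r := by
    refine intervalIntegral.integral_mono_on (by linarith) intervalIntegrable_const hint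
      fun r hr => ?_
    refine le_trans ?_ (hflux _ r (by linarith))
    have h5 := abs_le.1 (hf.abs_integral_sub_le hγ hK (continuous_ramp_sub (y + q * ε))
      (fun v => abs_ramp_le_one _) htm (t := r) ⟨by linarith [hr.1, htm.1],
        by linarith [hr.2, htm'.2]⟩)
    have h6 : |r - t| ≤ ε := by
      rw [abs_of_nonneg (by linarith [hr.1])]
      linarith [hr.2]
    have h7 := mul_le_mul_of_nonneg_left h6 hL0
    have h8 : tailCount f (y + q * ε) t - L * ε ≤ tailCount f (y + q * ε) r := by
      simp only [tailCount]
      linarith [h5.1]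
    exact mul_le_mul_of_nonneg_left h8 (by positivity)
  rw [intervalIntegral.integral_const, smul_eq_mul, add_sub_cancel_left] at h4
  have h9 : excess f (y + q * ε) (t + ε) - excess f (y + q * ε) t ≥
      q * ε * (tailCount f (y + q * ε) t - L * ε) := by
    rw [excess, excess, h3]
    linarith
  have h10 := mul_le_mul_of_nonneg_left h2 hqε
  have h11 : excess f y t - q * (C * q + L) * ε ^ 2 ≤ excess f (y + q * ε) (t + ε) := by
    nlinarith
  exact h11

/-- For a mass-conserving flow the volumes are bounded at each time before the last. -/
theorem exists_ae_le (hf : IsConservativeFlow γ K T C f) (hA : KernelAssumption γ K)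
    (hm : 0 < ∫ v : Vol, (v : ℝ) ∂(f 0)) {s : ℝ} (hs : 0 ≤ s) (hsT : s < T) :
    ∃ R : ℝ, 0 < R ∧ ∀ᵐ v : Vol ∂(f s), (v : ℝ) ≤ R := by
  have hγ := hA.one_lt
  have hb := hf.toIsBoundedFlow
  obtain ⟨Λ, hK⟩ := hA.exists_isBoundedKernel
  obtain ⟨H, c, hH, hc, hlow⟩ := hA.exists_lower_bound
  set m : ℝ := ∫ v : Vol, (v : ℝ) ∂(f 0) with hmdef
  -- The inner half is the mass kept after discarding large partners; the outer half is the
  -- prefactor of the weak equation.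
  set κ : ℝ := c * (m / 2) / 2 with hκ
  have hκ0 : 0 < κ := by positivity
  set ρ : ℝ := (2 : ℝ) ^ (1 - γ) with hρ
  have hρ0 : 0 ≤ ρ := by positivity
  have hρ1 : ρ < 1 := Real.rpow_lt_one_of_one_lt_of_neg (by norm_num) (by linarith)
  have hlim : Tendsto (fun R : ℝ => R ^ (1 - γ)) atTop (𝓝 0) := by
    have := tendsto_rpow_neg_atTop (y := γ - 1) (by linarith)
    simpa using this
  have hlim4 : Tendsto (fun R : ℝ => (R / 4) ^ (1 - γ) * C) atTop (𝓝 (0 * C)) :=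
    (hlim.comp (tendsto_id.atTop_div_const (by norm_num))).mul_const _
  have hlimS : Tendsto (fun R : ℝ => R ^ (1 - γ) * (κ⁻¹ * (1 - ρ)⁻¹)) atTop
      (𝓝 (0 * (κ⁻¹ * (1 - ρ)⁻¹))) := hlim.mul_const _
  rw [zero_mul] at hlim4 hlimS
  -- Beyond `R₀`, large partners carry at most half of the mass, all doublings together take at most
  -- `T - s`, and the lower bound on `K` applies.
  obtain ⟨R₀, hR₀⟩ := eventually_atTop.1 (((hlim4.eventually_le_const (half_pos hm)).and
    (hlimS.eventually_le_const (sub_pos.2 hsT))).and (eventually_ge_atTop H))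
  set R := max R₀ H with hRdef
  have hRH : H ≤ R := le_max_right _ _
  have hR : 0 < R := hH.trans_le hRH
  have hstage : ∀ r, R ≤ r → ∀ t, 0 ≤ t → t + r ^ (1 - γ) * κ⁻¹ ≤ T →
      excess f r t ≤ excess f (2 * r) (t + r ^ (1 - γ) * κ⁻¹) := by
    intro r hr t ht htT
    have hr0 : 0 < r := hR.trans_le hr
    have h := hf.excess_advance hγ hK (R := r) (q := κ * r ^ γ) hr0.le (by positivity)
      (fun y τ hy => ?_) ht (Δ := r ^ (1 - γ) * κ⁻¹) (by positivity) htT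
    · have h2 : r + κ * r ^ γ * (r ^ (1 - γ) * κ⁻¹) = 2 * r := by
        have h3 : r ^ γ * r ^ (1 - γ) = r := by
          rw [← Real.rpow_add hr0, add_sub_cancel, Real.rpow_one]
        calc r + κ * r ^ γ * (r ^ (1 - γ) * κ⁻¹)
            = r + (κ * κ⁻¹) * (r ^ γ * r ^ (1 - γ)) := by ring
          _ = 2 * r := by rw [h3, mul_inv_cancel₀ hκ0.ne']; ring
      rwa [h2] at h
    · have h4 := hb.collision_excess_ge hγ hK hc hlow hr0 (hRH.trans hr) hy (m := m) (t := τ) (by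
        rw [hf.mass τ]
        have := (hR₀ r ((le_max_left _ _).trans hr)).1.1
        linarith)
      have h5 : 2 * (κ * r ^ γ) = c * r ^ γ * (m / 2) := by rw [hκ]; ring
      rw [h5]
      exact h4
  -- The time at which volume `2 ^ j * R` is reached; successive durations have ratio `ρ = 2 ^ (1 -
  -- γ) < 1`.
  set τ : ℕ → ℝ := fun j => s + R ^ (1 - γ) * κ⁻¹ * ∑ i ∈ Finset.range j, ρ ^ i with hτ
  have hτT : ∀ j, τ j ≤ T := by
    intro j
    have h1 : ∑ i ∈ Finset.range j, ρ ^ i ≤ (1 - ρ)⁻¹ := by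
      rw [← tsum_geometric_of_lt_one hρ0 hρ1]
      exact (summable_geometric_of_lt_one hρ0 hρ1).sum_le_tsum _ fun i _ => by positivity
    have h2 := (hR₀ R (le_max_left _ _)).1.2
    have h3 := mul_le_mul_of_nonneg_left h1 (a := R ^ (1 - γ) * κ⁻¹) (by positivity)
    simp only [hτ]
    linarith
  have hiter : ∀ j : ℕ, excess f R s ≤ excess f (2 ^ j * R) (τ j) := by
    intro j
    induction j with
    | zero => simp [hτ]
    | succ j ih =>
      refine ih.trans ?_
      have hτ0 : 0 ≤ τ j := by
        have : 0 ≤ ∑ i ∈ Finset.range j, ρ ^ i := Finset.sum_nonneg fun i _ => by positivity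
        simp only [hτ]
        positivity
      have hpow : ((2 : ℝ) ^ j * R) ^ (1 - γ) = ρ ^ j * R ^ (1 - γ) := by
        rw [Real.mul_rpow (by positivity) hR.le, hρ, ← Real.rpow_natCast, ← Real.rpow_natCast,
          ← Real.rpow_mul (by norm_num), ← Real.rpow_mul (by norm_num), mul_comm (j : ℝ)]
      have hsucc : τ (j + 1) = τ j + (2 ^ j * R) ^ (1 - γ) * κ⁻¹ := by
        rw [hpow]
        simp only [hτ, Finset.sum_range_succ]
        ring
      have h1 := hstage (2 ^ j * R) (le_mul_of_one_le_left hR.le (one_le_pow₀ (by norm_num)))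
        (τ j) hτ0 (by rw [← hsucc]; exact hτT _)
      rw [hsucc, pow_succ, mul_comm ((2 : ℝ) ^ j) 2, mul_assoc]
      exact h1
  have hzero : excess f R s ≤ 0 := by
    have hlim2 : Tendsto (fun j : ℕ => ((2 : ℝ) ^ j * R) ^ (1 - γ) * C) atTop (𝓝 (0 * C)) :=
      (hlim.comp ((tendsto_pow_atTop_atTop_of_one_lt (by norm_num)).atTop_mul_const hR)).mul_const _
    rw [zero_mul] at hlim2
    exact ge_of_tendsto' hlim2 fun j => (hiter j).trans (hb.excess_le hγ (by positivity) _)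
  have hae := (integral_eq_zero_iff_of_nonneg (fun v : Vol => softPos_nonneg ((v : ℝ) - R))
    (hb.integrable_softPos hγ hR.le s)).1
    (le_antisymm hzero (integral_nonneg fun v => softPos_nonneg _))
  refine ⟨R, hR, ?_⟩
  filter_upwards [hae] with v hv
  by_contra hlt
  exact (softPos_pos (sub_pos.2 (not_le.1 hlt))).ne' hv

end IsConservativeFlow

end

/-! ### Propagation of the support -/

/-- The volume `a` belongs to the support of `μ`, tested on compactly supported functions. -/
def Charges (μ : Measure Vol) (a : Vol) : Prop :=
  ∀ φ : C_c(Vol, ℝ), (∀ v, 0 ≤ φ v) → 0 < φ a → 0 < ∫ v, φ v ∂μ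

theorem exists_abs_le (φ : C_c(Vol, ℝ)) : ∃ B : ℝ, ∀ v, |φ v| ≤ B :=
  φ.hasCompactSupport.exists_bound_of_continuous (map_continuous φ)

theorem exists_le_of_ne_zero (φ : C_c(Vol, ℝ)) :
    ∃ R : ℝ, 0 ≤ R ∧ ∀ v : Vol, φ v ≠ 0 → (v : ℝ) ≤ R := by
  obtain ⟨R, hR⟩ := φ.hasCompactSupport.isCompact.exists_bound_of_continuousOn
    (f := ((↑) : Vol → ℝ)) continuous_subtype_val.continuousOn
  refine ⟨max R 0, le_max_right _ _, fun v hv => ?_⟩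
  exact ((le_abs_self _).trans (hR v (subset_tsupport _ hv))).trans (le_max_left _ _)

/-- A backward Gronwall inequality. -/
theorem eq_zero_of_le_integral {u : ℝ → ℝ} (hu : Continuous u) {A s t : ℝ} (hA : 0 ≤ A)
    (hst : s ≤ t) (hu0 : 0 ≤ u s) (h : ∀ r ∈ Icc s t, u r ≤ A * ∫ x in r..t, u x) : u s = 0 := by
  -- The hypothesis says exactly that `Z' ≤ 0`. As `Z t = 0`, this gives `Z s ≥ 0`, so the integral
  -- of `u` over `[s, t]` is nonpositive.
  set Z : ℝ → ℝ := fun r => Real.exp (A * r) * ∫ x in t..r, u x with hZ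
  have hderiv : ∀ r, HasDerivAt Z (Real.exp (A * r) * (A * ∫ x in t..r, u x) +
      Real.exp (A * r) * u r) r := by
    intro r
    have h1 : HasDerivAt (fun r => Real.exp (A * r)) (Real.exp (A * r) * A) r := by
      simpa using ((hasDerivAt_id r).const_mul A).exp
    have h2 := (hu.integral_hasStrictDerivAt t r).hasDerivAt
    have h3 := h1.mul h2
    rw [mul_assoc] at h3
    exact h3
  have hanti : AntitoneOn Z (Icc s t) := by
    refine antitoneOn_of_deriv_nonpos (convex_Icc s t)
      (fun r _ => (hderiv r).continuousAt.continuousWithinAt)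
      (fun r _ => (hderiv r).differentiableAt.differentiableWithinAt) fun r hr => ?_
    rw [interior_Icc] at hr
    rw [(hderiv r).deriv, ← mul_add]
    refine mul_nonpos_of_nonneg_of_nonpos (Real.exp_pos _).le ?_
    have := h r ⟨hr.1.le, hr.2.le⟩
    rw [intervalIntegral.integral_symm] at this
    linarith
  have h1 := hanti (left_mem_Icc.2 hst) (right_mem_Icc.2 hst) hst
  simp only [hZ, intervalIntegral.integral_same, mul_zero] at h1
  have h2 : 0 ≤ ∫ x in t..s, u x := nonneg_of_mul_nonneg_right h1 (Real.exp_pos _)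
  have h3 := h s (left_mem_Icc.2 hst)
  rw [intervalIntegral.integral_symm] at h3
  nlinarith [mul_nonneg hA h2]

namespace IsConservativeFlow

variable {γ Λ T : ℝ} {C : ℝ≥0} {K : ℝ → ℝ → ℝ} {f : ℝ → Measure Vol}

/-- The gain term is dropped; where `φ ≠ 0` the volume is at most `R`, so the loss rate per particle
is bounded through the moments. -/
theorem neg_le_collision (hf : IsBoundedFlow γ C f) (hγ : 1 < γ) (hK : IsBoundedKernel γ Λ K)
    (φ : C_c(Vol, ℝ)) (hφ : ∀ v, 0 ≤ φ v) {R : ℝ} (hR0 : 0 ≤ R)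
    (hR : ∀ v : Vol, φ v ≠ 0 → (v : ℝ) ≤ R) (t : ℝ) :
    -(2 * (Λ * (R ^ γ + 1) * C) * ∫ v, φ v ∂(f t)) ≤ collision K f φ t := by
  have := hf.isFiniteMeasure t
  have hΛ := hK.const_nonneg
  obtain ⟨B, hB⟩ := exists_abs_le φ
  have hB' : ∀ v : Vol, |φ v - 0 * v| ≤ B := by simpa using hB
  have hi := hf.integrable_of_bounded t (map_continuous φ) hB
  have hone := hf.integrable_one_add_rpow t
  set A := Λ * (R ^ γ + 1) with hA
  have hA0 : 0 ≤ A := by positivity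
  have hpt : ∀ v v' : Vol, ((v : ℝ) ^ γ + (v' : ℝ) ^ γ) * φ v ≤
      (R ^ γ + 1) * (φ v * (1 + (v' : ℝ) ^ γ)) := by
    intro v v'
    have hv := v.2
    have hv' := v'.2
    by_cases h0 : φ v = 0
    · simp [h0]
    have h1 : (v : ℝ) ^ γ ≤ R ^ γ := Real.rpow_le_rpow hv.le (hR v h0) (by linarith)
    have h2 : 0 ≤ (v' : ℝ) ^ γ := by positivity
    have h3 : 0 ≤ R ^ γ := by positivity
    have h4 : (v : ℝ) ^ γ + (v' : ℝ) ^ γ ≤ (R ^ γ + 1) * (1 + (v' : ℝ) ^ γ) := by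
      nlinarith [mul_nonneg h2 h3]
    have h5 := mul_le_mul_of_nonneg_right h4 (hφ v)
    linarith
  have hint1 := hi.mul_prod hone
  have hint2 := hone.mul_prod hi
  have hle : ∫ p : Vol × Vol, -(A * (φ p.1 * (1 + (p.2 : ℝ) ^ γ) +
      (1 + (p.1 : ℝ) ^ γ) * φ p.2)) ∂((f t).prod (f t)) ≤ collision K f φ t := by
    refine integral_mono ((hint1.add hint2).const_mul A).neg
      (integrable_kernel_mul_theta hK hf (map_continuous φ) hB' t) fun p => ?_
    have h1 := hpt p.1 p.2
    have h2 := hpt p.2 p.1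
    have h3 := hK.le p.1 p.2
    have h4 := hK.nonneg p.1 p.2
    have h5 := mul_nonneg h4 (hφ (p.1 + p.2))
    have h6 := mul_le_mul_of_nonneg_right h3 (add_nonneg (hφ p.1) (hφ p.2))
    have h7 := mul_le_mul_of_nonneg_left (add_le_add h1 h2) hΛ
    simp only [Theta]
    rw [hA]
    linarith
  refine le_trans ?_ hle
  rw [integral_neg, integral_const_mul, integral_add hint1 hint2, integral_prod_mul φ
    (fun v : Vol => 1 + (v : ℝ) ^ γ), integral_prod_mul (fun v : Vol => 1 + (v : ℝ) ^ γ) φ]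
  have h8 := mul_le_mul_of_nonneg_left (hf.integral_one_add_rpow_le t)
    (mul_nonneg hA0 (integral_nonneg (μ := f t) hφ))
  linarith

/-- A region that is empty at some time was empty before. -/
theorem integral_eq_zero_of_le (hf : IsConservativeFlow γ K T C f) (hγ : 1 < γ)
    (hK : IsBoundedKernel γ Λ K) (φ : C_c(Vol, ℝ)) (hφ : ∀ v, 0 ≤ φ v) {s t : ℝ}
    (hs : 0 ≤ s) (hst : s ≤ t) (htT : t ≤ T) (h0 : ∫ v, φ v ∂(f t) = 0) :
    ∫ v, φ v ∂(f s) = 0 := by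
  have hb := hf.toIsBoundedFlow
  have hΛ := hK.const_nonneg
  obtain ⟨B, hB⟩ := exists_abs_le φ
  have hB' : ∀ v : Vol, |φ v - 0 * v| ≤ B := by simpa using hB
  obtain ⟨R, hR0, hR⟩ := exists_le_of_ne_zero φ
  set A := Λ * (R ^ γ + 1) * C with hA
  refine eq_zero_of_le_integral (u := fun r => ∫ v, φ v ∂(f r)) (A := A) (t := t)
    (hb.continuous φ) (by positivity) hst (integral_nonneg hφ) fun r hr => ?_
  have h1 := hf.weak_eq_test hγ hK (map_continuous φ) hB' (s := r) (t := t)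
    ⟨hs.trans hr.1, hr.2.trans htT⟩ ⟨hs.trans hst, htT⟩
  have h2 : ∫ x in r..t, -(2 * A * ∫ v, φ v ∂(f x)) ≤ ∫ x in r..t, collision K f φ x :=
    intervalIntegral.integral_mono_on hr.2
      ((continuous_const.mul (hb.continuous φ)).neg.intervalIntegrable _ _)
      (intervalIntegrable_collision hK hb (map_continuous φ) hB' r t)
      fun x _ => neg_le_collision hb hγ hK φ hφ hR0 hR x
  rw [intervalIntegral.integral_neg, intervalIntegral.integral_const_mul] at h2
  rw [h0] at h1
  linarith

theorem charges_mono (hf : IsConservativeFlow γ K T C f) (hγ : 1 < γ)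
    (hK : IsBoundedKernel γ Λ K) {a : Vol} {s t : ℝ}
    (hs : 0 ≤ s) (hst : s ≤ t) (htT : t ≤ T) (h : Charges (f s) a) : Charges (f t) a := by
  intro φ hφ ha
  refine (integral_nonneg hφ).lt_of_ne fun h0 => ?_
  exact (h φ hφ ha).ne' (hf.integral_eq_zero_of_le hγ hK φ hφ hs hst htT h0.symm)

/-- Particles of two different volumes coagulate instantaneously. -/
theorem charges_add (hf : IsConservativeFlow γ K T C f) (hA : KernelAssumption γ K)
    {a b : Vol} (hab : a ≠ b) {s t : ℝ} (hs : 0 ≤ s) (hst : s < t) (htT : t ≤ T)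
    (ha : Charges (f s) a) (hb : Charges (f s) b) : Charges (f t) (a + b) := by
  have hγ := hA.one_lt
  obtain ⟨Λ, hK⟩ := hA.exists_isBoundedKernel
  have hfl := hf.toIsBoundedFlow
  intro φ hφ hφab
  refine (integral_nonneg hφ).lt_of_ne fun h0 => ?_
  obtain ⟨B, hB⟩ := exists_abs_le φ
  have hB' : ∀ v : Vol, |φ v - 0 * v| ≤ B := by simpa using hB
  -- If `φ` sees nothing at time `t`, it saw nothing during `[s, t]`. Losses then vanish and the
  -- weak equation equates zero with a positive gain.
  have hzero : ∀ τ ∈ Icc s t, ∫ v, φ v ∂(f τ) = 0 := fun τ hτ =>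
    hf.integral_eq_zero_of_le hγ hK φ hφ (hs.trans hτ.1) hτ.2 htT h0.symm
  set F : Vol × Vol → ℝ := fun p => K p.1 p.2 * φ (p.1 + p.2) with hF
  have hFcont : Continuous F := by
    have : Continuous fun p : Vol × Vol => p.1 + p.2 :=
      Continuous.subtype_mk (by fun_prop) _
    exact hK.continuous.mul ((map_continuous φ).comp this)
  have hF0 : ∀ p, 0 ≤ F p := fun p => mul_nonneg (hK.nonneg _ _) (hφ _)
  have hFab : 0 < F (a, b) := mul_pos (hA.pos_of_ne hab) hφab
  set κ := F (a, b) / 2 with hκ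
  obtain ⟨ε, hε, hball⟩ := Metric.isOpen_iff.1 (isOpen_lt continuous_const hFcont) (a, b)
    (show κ < F (a, b) by linarith)
  -- Small enough for both bumps to stay in `(0, ∞)` and for the product of their supports to lie
  -- where `F > κ`, up to the boundary, where the bumps vanish.
  set r := min ε (min (a : ℝ) b / 2) with hr
  have hr0 : 0 < r := lt_min hε (half_pos (lt_min a.2 b.2))
  have hmin := lt_min a.2 b.2
  have hra : r < a := by
    have h1 : r ≤ min (a : ℝ) b / 2 := min_le_right _ _
    have h2 := min_le_left (a : ℝ) b
    linarith
  have hrb : r < b := by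
    have h1 : r ≤ min (a : ℝ) b / 2 := min_le_right _ _
    have h2 := min_le_right (a : ℝ) b
    linarith
  set χa := bump a r hr0 hra with hχa
  set χb := bump b r hr0 hrb with hχb
  have hlow : ∀ p : Vol × Vol, κ * (χa p.1 * χb p.2) ≤ F p := by
    intro p
    by_cases h1 : r ≤ |(p.1 : ℝ) - a|
    · rw [hχa, bump_eq_zero a r hr0 hra _ h1]
      simpa using hF0 p
    by_cases h2 : r ≤ |(p.2 : ℝ) - b|
    · rw [hχb, bump_eq_zero b r hr0 hrb _ h2]
      simpa using hF0 p
    rw [not_le] at h1 h2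
    have hmem : p ∈ Metric.ball (a, b) ε := by
      rw [Metric.mem_ball, Prod.dist_eq, max_lt_iff]
      exact ⟨h1.trans_le (min_le_left _ _), h2.trans_le (min_le_left _ _)⟩
    have h3 : κ < F p := hball hmem
    have h4 : χa p.1 * χb p.2 ≤ 1 := mul_le_one₀ (bump_le_one _ _ _ _ _) (bump_nonneg _ _ _ _ _)
      (bump_le_one _ _ _ _ _)
    exact (mul_le_of_le_one_right (by linarith) h4).trans h3.le
  have hcol : ∀ τ ∈ Icc s t, κ * ((∫ v, χa v ∂(f τ)) * ∫ v, χb v ∂(f τ)) ≤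
      collision K f φ τ := by
    intro τ hτ
    have := hfl.isFiniteMeasure τ
    have hae : ∀ᵐ v ∂(f τ), φ v = 0 := (integral_eq_zero_iff_of_nonneg hφ
      (hfl.integrable_of_bounded τ (map_continuous φ) hB)).1 (hzero τ hτ)
    have hae1 : ∀ᵐ p ∂((f τ).prod (f τ)), φ p.1 = 0 :=
      Measure.quasiMeasurePreserving_fst.ae hae
    have hae2 : ∀ᵐ p ∂((f τ).prod (f τ)), φ p.2 = 0 :=
      Measure.quasiMeasurePreserving_snd.ae hae
    have hi : ∀ (c : Vol) (hrc : r < c), Integrable (bump c r hr0 hrc) (f τ) := fun c hrc =>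
      hfl.integrable_of_bounded τ (map_continuous (bump c r hr0 hrc)) (B := 1) fun v => by
        rw [abs_of_nonneg (bump_nonneg _ _ _ _ _)]
        exact bump_le_one _ _ _ _ _
    rw [← integral_prod_mul, ← integral_const_mul]
    refine integral_mono_ae (((hi a hra).mul_prod (hi b hrb)).const_mul κ)
      (integrable_kernel_mul_theta hK hfl (map_continuous φ) hB' τ) ?_
    filter_upwards [hae1, hae2] with p h1 h2
    simp only [Theta, h1, h2, sub_zero]
    exact hlow p
  have hint : IntervalIntegrable (fun τ => κ * ((∫ v, χa v ∂(f τ)) * ∫ v, χb v ∂(f τ)))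
      volume s t :=
    (continuous_const.mul ((hfl.continuous χa).mul (hfl.continuous χb))).intervalIntegrable _ _
  have hpos : 0 < ∫ τ in s..t, κ * ((∫ v, χa v ∂(f τ)) * ∫ v, χb v ∂(f τ)) := by
    refine intervalIntegral.intervalIntegral_pos_of_pos_on hint (fun τ hτ => ?_) hst
    have h1 := hf.charges_mono hγ hK hs hτ.1.le (hτ.2.le.trans htT) ha χa
      (bump_nonneg _ _ _ _) (by rw [bump_self]; exact one_pos)
    have h2 := hf.charges_mono hγ hK hs hτ.1.le (hτ.2.le.trans htT) hb χb
      (bump_nonneg _ _ _ _) (by rw [bump_self]; exact one_pos)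
    exact mul_pos (by linarith) (mul_pos h1 h2)
  have hmono := intervalIntegral.integral_mono_on hst.le hint
    (intervalIntegrable_collision hK hfl (map_continuous φ) hB' s t) hcol
  have hw := hf.weak_eq_test hγ hK (map_continuous φ) hB' ⟨hs, hst.le.trans htT⟩ ⟨hs.trans hst.le, htT⟩
  rw [← h0, hzero s (left_mem_Icc.2 hst.le)] at hw
  linarith

/-- Each further collision with `b` uses up half of the remaining time. The strict bound gives `c >
b`, so `c ≠ b` and the pair does react. -/
theorem exists_charges_gt (hf : IsConservativeFlow γ K T C f) (hA : KernelAssumption γ K)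
    {a b : Vol} (hab : a ≠ b) (ha : Charges (f 0) a) (hb : Charges (f 0) b) (n : ℕ) :
    ∀ t, 0 < t → t ≤ T →
      ∃ c : Vol, (b : ℝ) + n * b < c ∧ Charges (f t) c := by
  have hγ := hA.one_lt
  obtain ⟨Λ, hK⟩ := hA.exists_isBoundedKernel
  induction n with
  | zero =>
    intro t ht htT
    refine ⟨a + b, ?_, hf.charges_add hA hab le_rfl ht htT ha hb⟩
    have := a.2
    simp only [Positive.coe_add, Nat.cast_zero, zero_mul, add_zero]
    linarith
  | succ n ih =>
    intro t ht htT
    obtain ⟨c, hc, hcc⟩ := ih (t / 2) (by linarith) (by linarith)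
    have hb0 := b.2
    have hnb : 0 ≤ (n : ℝ) * b := by positivity
    refine ⟨c + b, ?_, hf.charges_add hA (fun h => ?_) (by linarith) (half_lt_self ht) htT hcc
      (hf.charges_mono hγ hK le_rfl (by linarith) (by linarith) hb)⟩
    · push_cast
      linarith
    · rw [h] at hc
      linarith

/-- At time `T / 2` the support is bounded by `exists_ae_le`, yet two distinct initial points would
have made it unbounded. -/
theorem eq_of_charges (hf : IsConservativeFlow γ K T C f) (hA : KernelAssumption γ K)
    (hT : 0 < T) (hm : 0 < ∫ v : Vol, (v : ℝ) ∂(f 0)) {a b : Vol}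
    (ha : Charges (f 0) a) (hb : Charges (f 0) b) : a = b := by
  by_contra hab
  obtain ⟨R, hR, hae⟩ := hf.exists_ae_le hA hm (half_pos hT).le (half_lt_self hT)
  obtain ⟨n, hn⟩ := exists_nat_gt (R / b)
  rw [div_lt_iff₀ b.2] at hn
  obtain ⟨c, hc, hcc⟩ := hf.exists_charges_gt hA hab ha hb n (T / 2) (half_pos hT) (by linarith)
  have hb0 := b.2
  have hcR : 0 < (c : ℝ) - R := by linarith
  have hpos := hcc (bump c ((c : ℝ) - R) hcR (by linarith)) (bump_nonneg _ _ _ _)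
    (by rw [bump_self]; exact one_pos)
  refine hpos.ne' (integral_eq_zero_of_ae ?_)
  filter_upwards [hae] with v hv
  refine bump_eq_zero _ _ _ _ _ ?_
  rw [abs_sub_comm]
  exact le_trans (by linarith) (le_abs_self _)

end IsConservativeFlow

/-- Uncharged points have null neighbourhoods, and locally null sets are null. So a nonzero measure
charges some point, and the complement of the only charged point is null. -/
theorem eq_smul_dirac_of_charges_unique {μ : Measure Vol} [IsFiniteMeasure μ] (hμ : μ ≠ 0)
    (h : ∀ a b, Charges μ a → Charges μ b → a = b) :
    ∃ (M : ℝ) (V : Vol), 0 < M ∧ μ = ENNReal.ofReal M • Measure.dirac V := by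
  have hnull : ∀ a, ¬ Charges μ a → ∃ U ∈ 𝓝 a, μ U = 0 := by
    intro a ha
    simp only [Charges, not_forall, not_lt] at ha
    obtain ⟨φ, hφ, hφa, hle⟩ := ha
    obtain ⟨B, hB⟩ := exists_abs_le φ
    have hi : Integrable φ μ := (integrable_const B).mono' (map_continuous φ).aestronglyMeasurable
      (Eventually.of_forall hB)
    have hae := (integral_eq_zero_iff_of_nonneg hφ hi).1 (le_antisymm hle (integral_nonneg hφ))
    refine ⟨{v | 0 < φ v}, (isOpen_lt continuous_const (map_continuous φ)).mem_nhds hφa, ?_⟩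
    refine measure_mono_null (fun v hv => ?_) (ae_iff.1 hae)
    exact (show 0 < φ v from hv).ne'
  obtain ⟨V, hV⟩ : ∃ V, Charges μ V := by
    by_contra! hno
    refine hμ (Measure.measure_univ_eq_zero.1 (measure_null_of_locally_null _ fun a _ => ?_))
    obtain ⟨U, hU, hU0⟩ := hnull a (hno a)
    exact ⟨U, mem_nhdsWithin_of_mem_nhds hU, hU0⟩
  have hcompl : μ {V}ᶜ = 0 := measure_null_of_locally_null _ fun a ha => by
    obtain ⟨U, hU, hU0⟩ := hnull a fun hc => ha (h a V hc hV)
    exact ⟨U, mem_nhdsWithin_of_mem_nhds hU, hU0⟩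
  have hdirac : μ = μ {V} • Measure.dirac V := by
    rw [← Measure.restrict_singleton, Measure.restrict_eq_self_of_ae_mem]
    exact hcompl
  have hpos : μ {V} ≠ 0 := fun h0 => hμ (by rw [hdirac, h0, zero_smul])
  refine ⟨(μ {V}).toReal, V, ENNReal.toReal_pos hpos (measure_ne_top _ _), ?_⟩
  rw [ENNReal.ofReal_toReal (measure_ne_top _ _)]
  exact hdirac

/-! ### From solutions to flows defined for all times -/

/-- A mass-conserving solution, restricted to a finite time interval and extended by constants,
is a conservative flow. -/
theorem IsMassConservingSolution.exists_isConservativeFlow {γ : ℝ} {K : ℝ → ℝ → ℝ}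
    {T : ℝ≥0∞} {fin : Measure Vol} {f : ℝ → Measure Vol} (hA : KernelAssumption γ K) (hT : 0 < T)
    (hf : IsMassConservingSolution γ K T fin f) :
    ∃ (T₀ : ℝ) (C : ℝ≥0) (F : ℝ → Measure Vol), 0 < T₀ ∧ F 0 = f 0 ∧
      IsConservativeFlow γ K T₀ C F := by
  have hγ := hA.one_lt
  obtain ⟨Λ, hK⟩ := hA.exists_isBoundedKernel
  -- Any positive finite horizon is enough, and truncating at `1` covers `T = ∞`.
  have hmintop : min T 1 ≠ ∞ := ne_top_of_le_ne_top ENNReal.one_ne_top (min_le_right _ _)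
  set T₀ : ℝ := (min T 1).toReal with hT₀
  have hT₀pos : 0 < T₀ := ENNReal.toReal_pos (lt_min hT one_pos).ne' hmintop
  have hmem : ∀ t ∈ Icc 0 T₀, t ∈ timeInterval T := fun t ht =>
    ⟨ht.1, (ENNReal.ofReal_le_of_le_toReal ht.2).trans (min_le_left _ _)⟩
  set clamp : ℝ → ℝ := fun t => max 0 (min t T₀) with hclamp
  have hclamp_mem : ∀ t, clamp t ∈ timeInterval T := fun t =>
    hmem _ ⟨le_max_left _ _, max_le hT₀pos.le (min_le_right _ _)⟩
  have hclamp_eq : ∀ t ∈ Icc 0 T₀, clamp t = t := fun t ht => by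
    simp only [hclamp, min_eq_left ht.2, max_eq_right ht.1]
  have h0mem : (0 : ℝ) ∈ Icc 0 T₀ := left_mem_Icc.2 hT₀pos.le
  obtain ⟨C, hC⟩ := hf.moment_bound
  have hb : IsBoundedFlow γ C fun t => f (clamp t) :=
    ⟨fun φ => (hf.continuous φ).comp_continuous (by fun_prop) hclamp_mem,
      fun t => hC _ (hclamp_mem t)⟩
  refine ⟨T₀, C, fun t => f (clamp t), hT₀pos, by simp only [hclamp_eq 0 h0mem], hb,
    fun φ t ht => ?_, fun t => ?_⟩
  · have h0 := hf.weak_eq φ 0 (hmem 0 h0mem)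
    rw [intervalIntegral.integral_same, mul_zero, sub_eq_zero] at h0
    simp only [hclamp_eq 0 h0mem, hclamp_eq t ht]
    rw [h0, hf.weak_eq φ t (hmem t ht)]
    congr 1
    refine intervalIntegral.integral_congr fun s hs => ?_
    rw [uIcc_of_le ht.1] at hs
    obtain ⟨B, hB⟩ := exists_abs_le φ
    have hB' : ∀ v : Vol, |φ v - 0 * v| ≤ B := by simpa using hB
    have := hb.isFiniteMeasure s
    -- The weak equation integrates over `v` inside and `v'` outside, the reverse of the default
    -- order for the product measure.
    have h1 := integral_prod_symm _
      (integrable_kernel_mul_theta hK hb (map_continuous φ) hB' s)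
    simp only [collision]
    rw [h1]
    simp only [hclamp_eq s ⟨hs.1, hs.2.trans ht.2⟩]
  · have h1 : ∀ t, ∫ v : Vol, (v : ℝ) ∂(f (clamp t)) =
        (∫⁻ v : Vol, ENNReal.ofReal (v : ℝ) ∂fin).toReal := fun t => by
      rw [integral_eq_lintegral_of_nonneg_ae (Eventually.of_forall fun v : Vol => v.2.le)
        (by fun_prop), hf.mass_conserved _ (hclamp_mem t)]
    rw [h1, h1]

/-- A monodisperse distribution is a stationary solution. -/
theorem isMassConservingSolution_dirac {γ : ℝ} {K : ℝ → ℝ → ℝ} (hA : KernelAssumption γ K)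
    (T : ℝ≥0∞) (M : ℝ) (V : Vol) :
    IsMassConservingSolution γ K T (ENNReal.ofReal M • Measure.dirac V)
      fun _ => ENNReal.ofReal M • Measure.dirac V where
  radon _ _ := by
    have : IsFiniteMeasure (ENNReal.ofReal M • Measure.dirac V) :=
      Measure.smul_finite _ ENNReal.ofReal_ne_top
    infer_instance
  continuous _ := continuousOn_const
  moment_bound := by
    refine ⟨Real.toNNReal M * Real.toNNReal (1 + (V : ℝ) ^ γ), fun _ _ => ?_⟩
    rw [lintegral_smul_measure, lintegral_dirac, ENNReal.coe_mul]
    rfl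
  -- The product of the Dirac mass with itself sits on the diagonal, where `K` vanishes.
  weak_eq φ t _ := by
    simp [integral_smul_measure, hA.diagonal]
  mass_conserved _ _ := rfl

end Coagulation

theorem corollary1p7 (γ : ℝ) (K : ℝ → ℝ → ℝ) (hK : Coagulation.KernelAssumption γ K)
    (fin : Measure Coagulation.Vol) (hfin : IsLocallyFiniteMeasure fin) (hfin0 : fin ≠ 0)
    (T : ℝ≥0∞) (hT : 0 < T) :
    (∃ f : ℝ → Measure Coagulation.Vol, Coagulation.IsMassConservingSolution γ K T fin f) ↔
      ∃ (M : ℝ) (V : Coagulation.Vol), 0 < M ∧ fin = ENNReal.ofReal M • Measure.dirac V := by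
  constructor
  · rintro ⟨f, hf⟩
    have h0mem : (0 : ℝ) ∈ Coagulation.timeInterval T := ⟨le_rfl, by simp⟩
    have hrad := hf.radon 0 h0mem
    -- At time zero the weak equation only equates pairings with compactly supported functions;
    -- these determine a locally finite measure.
    have heq : f 0 = fin := by
      have : LocallyCompactSpace Coagulation.Vol := isOpen_Ioi.locallyCompactSpace
      refine Measure.ext_of_integral_eq_on_compactlySupported fun φ => ?_
      have h0 := hf.weak_eq φ 0 h0mem
      rwa [intervalIntegral.integral_same, mul_zero, sub_eq_zero] at h0
    obtain ⟨T₀, C, F, hT₀, hF0, hF⟩ := hf.exists_isConservativeFlow hK hT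
    rw [heq] at hF0
    have hfinite : IsFiniteMeasure fin := hF0 ▸ hF.isFiniteMeasure 0
    have hm : 0 < ∫ v : Coagulation.Vol, (v : ℝ) ∂(F 0) := by
      refine (integral_nonneg fun v => v.2.le).lt_of_ne fun h0 => hfin0 ?_
      have hae := (integral_eq_zero_iff_of_nonneg (fun v : Coagulation.Vol => v.2.le)
        (hF.integrable_vol hK.one_lt 0)).1 h0.symm
      rw [hF0] at hae
      refine Measure.measure_univ_eq_zero.1 (measure_mono_null (fun v _ => ?_) (ae_iff.1 hae))
      exact v.2.ne'
    refine Coagulation.eq_smul_dirac_of_charges_unique hfin0 fun a b ha hb => ?_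
    rw [← hF0] at ha hb
    exact hF.eq_of_charges hK hT₀ hm ha hb
  · rintro ⟨M, V, -, rfl⟩
    exact ⟨_, Coagulation.isMassConservingSolution_dirac hK T M V⟩
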